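/- Let $k$ be a field. A degree sequence is a strictly increasing tuple of integers $d=(d_0,\dots,d_n)$. An integral point on its pure ray is a tuple of nonnegative integers $(\beta_0,\dots,\beta_n)$ satisfying the Herzog--K\"uhl equations $\sum_{i=0}^n(-1)^i\beta_i d_i^m=0$ for $m=0,\dots,n-1$; it stands for the table with entry $\beta_i$ in position $(i,d_i)$ for $0\le i\le n$ and $0$ in all other positions. For a positively graded Lie algebra $\mathfrak g=\bigoplus_{i\ge1}\mathfrak g_i$ over $k$ (with bracket of degree zero), $U(\mathfrak g)$ carries the induced grading, and the Betti table of a finitely generated $\mathbb Z$-graded $U(\mathfrak g)$-module $M$ has entries $\beta_{i,j}(M)=\dim_k\operatorname{Tor}_i^{U(\mathfrak g)}(M,k)_j$ for $i\ge 0$, $j\in\mathbb Z$. For $n=4$, $d=(0,1,4,5,6)$ is a degree sequence, and $\beta=(1,2,5,6,2)$ is the primitive integral point on its pure ray: it is an integral point, its coordinates have greatest common divisor $1$, and every integral point on the ray is a nonnegative integer multiple of it. For every $4$-dimensional positively graded Lie algebra $\mathfrak g$ over $k$ that is generated as a Lie algebra by $\mathfrak g_1$, and every $\mathbb Z$-graded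 $U(\mathfrak g)$-module $M$ of finite length, the Betti table of $M$ is not the table of this integral point; that is, it is not the case that $\beta_{i,d_i}(M)=\beta_i$ for $0\le i\le4$ and $\beta_{i,j}(M)=0$ for all other $(i,j)$. -/

import Mathlib

universe u v w

/-! ### Degree sequences and pure rays -/

/-- `β` is an integral point on the pure ray of the degree sequence `d = (d_0, …, d_n)`:
a tuple of nonnegative integers satisfying the Herzog–Kühl equations
`∑ i, (-1)^i β_i d_i^m = 0` for `m = 0, …, n - 1`. -/
def IsIntegralPoint {n : ℕ} (d : Fin (n + 1) → ℤ) (β : Fin (n + 1) → ℕ) : Prop :=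
  ∀ m : ℕ, m < n → ∑ i : Fin (n + 1), (-1 : ℤ) ^ (i : ℕ) * (β i : ℤ) * d i ^ m = 0

/-- `β` is the primitive integral point on the pure ray of `d`: an integral point with coprime
coordinates, of which every integral point on the ray is a multiple. -/
def IsPrimitiveIntegralPoint {n : ℕ} (d : Fin (n + 1) → ℤ) (β : Fin (n + 1) → ℕ) : Prop :=
  IsIntegralPoint d β ∧ Finset.univ.gcd β = 1 ∧
    ∀ β' : Fin (n + 1) → ℕ, IsIntegralPoint d β' → ∃ c : ℕ, β' = c • β

/-- The table supported in the positions `(i, d_i)`, with entry `β_i` in position `(i, d_i)`. -/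
def pureTable {n : ℕ} (d : Fin (n + 1) → ℤ) (β : Fin (n + 1) → ℕ) (i : ℕ) (j : ℤ) : ℕ :=
  if h : i < n + 1 then if d ⟨i, h⟩ = j then β ⟨i, h⟩ else 0 else 0

/-! ### The enveloping algebra of a graded Lie algebra: grading and augmentation -/

/-- The degree `n` part of `U(𝔤)` for a graded Lie algebra `𝔤`: the span of the products
`x_1 ⋯ x_r` of homogeneous elements of `𝔤` whose degrees add up to `n`. -/
def envelopingGrading {k : Type u} [Field k] {𝔤 : Type v} [LieRing 𝔤] [LieAlgebra k 𝔤]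
    (𝓰 : ℕ → Submodule k 𝔤) (n : ℤ) : Submodule k (UniversalEnvelopingAlgebra k 𝔤) :=
  Submodule.span k {a | ∃ l : List (ℕ × 𝔤), (∀ p ∈ l, p.2 ∈ 𝓰 p.1) ∧
    ((l.map fun p => (p.1 : ℤ)).sum = n) ∧
    (l.map fun p => UniversalEnvelopingAlgebra.ι k p.2).prod = a}

section

attribute [local instance 100] LieRing.ofAssociativeRing

/-- The augmentation `U(𝔤) → k`, which sends `𝔤` to `0`; it makes `k` the trivial module. -/
noncomputable def augmentation (k : Type u) [Field k] (𝔤 : Type v) [LieRing 𝔤]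
    [LieAlgebra k 𝔤] : UniversalEnvelopingAlgebra k 𝔤 →ₐ[k] k :=
  UniversalEnvelopingAlgebra.lift k (0 : 𝔤 →ₗ⁅k⁆ k)

end

/-! ### Graded free resolutions, Tor and Betti tables -/

/-- The degree `j` part of the graded free left `U(𝔤)`-module on a set `ι` of homogeneous
generators, where the generator `x` has degree `δ x`. -/
def freeGrading {k : Type u} [Field k] {𝔤 : Type v} [LieRing 𝔤] [LieAlgebra k 𝔤]
    (𝓰 : ℕ → Submodule k 𝔤) {ι : Type*} (δ : ι → ℤ) (j : ℤ) :
    Submodule k (ι →₀ UniversalEnvelopingAlgebra k 𝔤) where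
  carrier := {f | ∀ x, f x ∈ envelopingGrading 𝓰 (j - δ x)}
  add_mem' hf hg x := add_mem (hf x) (hg x)
  zero_mem' _ := zero_mem _
  smul_mem' c _ hf x := Submodule.smul_mem _ c (hf x)

/-- The functor `k ⊗_{U(𝔤)} -` on maps of free left `U(𝔤)`-modules: with the identification
`k ⊗_{U(𝔤)} U(𝔤)^(ι) = k^(ι)`, it applies the augmentation to each matrix entry. -/
noncomputable def tensorTrivial {k : Type u} [Field k] {𝔤 : Type v} [LieRing 𝔤]
    [LieAlgebra k 𝔤] {ι κ : Type*}
    (φ : (ι →₀ UniversalEnvelopingAlgebra k 𝔤) →ₗ[UniversalEnvelopingAlgebra k 𝔤]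
      (κ →₀ UniversalEnvelopingAlgebra k 𝔤)) :
    (ι →₀ k) →ₗ[k] (κ →₀ k) :=
  Finsupp.linearCombination k fun x =>
    Finsupp.mapRange.linearMap (augmentation k 𝔤).toLinearMap (φ (Finsupp.single x 1))

/-- A graded free resolution
`⋯ → F_2 → F_1 → F_0 → M → 0` of the graded left `U(𝔤)`-module `M = ⨁ j, 𝓜 j`:
`F_i` is free on a set `ι i` of homogeneous generators of degrees `δ i`, all maps are
`U(𝔤)`-linear of degree zero, and the sequence is exact. -/
structure GradedFreeResolution {k : Type u} [Field k] {𝔤 : Type v} [LieRing 𝔤]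
    [LieAlgebra k 𝔤] (𝓰 : ℕ → Submodule k 𝔤) {M : Type w} [AddCommGroup M] [Module k M]
    [Module (UniversalEnvelopingAlgebra k 𝔤) M] (𝓜 : ℤ → Submodule k M) where
  ι : ℕ → Type (max u v w)
  δ : ∀ i, ι i → ℤ
  d : ∀ i, (ι (i + 1) →₀ UniversalEnvelopingAlgebra k 𝔤) →ₗ[UniversalEnvelopingAlgebra k 𝔤]
    (ι i →₀ UniversalEnvelopingAlgebra k 𝔤)
  ε : (ι 0 →₀ UniversalEnvelopingAlgebra k 𝔤) →ₗ[UniversalEnvelopingAlgebra k 𝔤] M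
  d_homogeneous : ∀ i j, ∀ f ∈ freeGrading 𝓰 (δ (i + 1)) j, d i f ∈ freeGrading 𝓰 (δ i) j
  ε_homogeneous : ∀ j, ∀ f ∈ freeGrading 𝓰 (δ 0) j, ε f ∈ 𝓜 j
  exact : ∀ i, Function.Exact (d (i + 1)) (d i)
  exact_zero : Function.Exact (d 0) ε
  ε_surjective : Function.Surjective ε

namespace GradedFreeResolution

variable {k : Type u} [Field k] {𝔤 : Type v} [LieRing 𝔤] [LieAlgebra k 𝔤]
  {𝓰 : ℕ → Submodule k 𝔤} {M : Type w} [AddCommGroup M] [Module k M]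
  [Module (UniversalEnvelopingAlgebra k 𝔤) M] {𝓜 : ℤ → Submodule k M}

/-- The cycles of the complex `k ⊗_{U(𝔤)} F` in homological degree `i`. -/
noncomputable def cycles (F : GradedFreeResolution 𝓰 𝓜) : ∀ i, Submodule k (F.ι i →₀ k)
  | 0 => ⊤
  | i + 1 => LinearMap.ker (tensorTrivial (F.d i))

/-- The boundaries of the complex `k ⊗_{U(𝔤)} F` in homological degree `i`. -/
noncomputable def boundaries (F : GradedFreeResolution 𝓰 𝓜) (i : ℕ) :
    Submodule k (F.ι i →₀ k) :=
  LinearMap.range (tensorTrivial (F.d i))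

/-- The cycles of internal degree `j`. -/
noncomputable def cyclesOfDegree (F : GradedFreeResolution 𝓰 𝓜) (i : ℕ) (j : ℤ) :
    Submodule k (F.ι i →₀ k) :=
  F.cycles i ⊓ Finsupp.supported k k {x | F.δ i x = j}

/-- `Tor_i(M, k)_j`, the degree `j` part of the `i`-th homology of `k ⊗_{U(𝔤)} F`: the classes of
the cycles of degree `j` modulo the boundaries. -/
noncomputable def Tor (F : GradedFreeResolution 𝓰 𝓜) (i : ℕ) (j : ℤ) :
    Submodule k ((F.ι i →₀ k) ⧸ F.boundaries i) :=
  (F.cyclesOfDegree i j).map (F.boundaries i).mkQ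

end GradedFreeResolution

/-- `b` is the Betti table of the graded left `U(𝔤)`-module `M = ⨁ j, 𝓜 j`, that is,
`b i j = dim_k Tor_i(M, k)_j` for all `i` and `j`, where `Tor` is computed from a graded free
resolution of `M` (it does not depend on which one). -/
def IsBettiTable {k : Type u} [Field k] {𝔤 : Type v} [LieRing 𝔤] [LieAlgebra k 𝔤]
    (𝓰 : ℕ → Submodule k 𝔤) {M : Type w} [AddCommGroup M] [Module k M]
    [Module (UniversalEnvelopingAlgebra k 𝔤) M] (𝓜 : ℤ → Submodule k M) (b : ℕ → ℤ → ℕ) :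
    Prop :=
  ∃ F : GradedFreeResolution 𝓰 𝓜, ∀ i j, Module.rank k (F.Tor i j) = (b i j : Cardinal)

/-! The argument reads off the start of the resolution and finds a syzygy one degree too low. Write
`U` for the enveloping algebra. The entries of the table in homological degrees 0 and 1 force `M` to
be cyclic, generated by some `m₀` of degree 0 (`exists_generator`), with annihilator generated as a
left ideal by two linearly independent elements of degree 1 (`annihilatorOfDegree_le`,
`finrank_annihilatorOfDegree_one`). These are images of independent `x, y` in the degree one part of
the Lie algebra. Since the entries in homological degree 2 vanish below degree 4, `x` and `y` have
no nonzero syzygy of degree 3 (`syzygy_eq_zero`).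

On the other hand, `x`, `y`, `[x,y]`, `[x,[x,y]]`, `[y,[x,y]]` cannot be independent in dimension
four. The grading separates degrees 1, 2 and 3, so some nontrivial combination of the two triple
brackets vanishes (`exists_bracket_relation`). Expanded in `U`, every monomial of that combination
ends in `x` or `y`, so it reads `p * x + q * y = 0` with `p, q` of degree 2
(`exists_syzygy_of_degree_three`). Two characters of `U` show that `p` and `q` are not both zero, in
every characteristic and without a Poincaré–Birkhoff–Witt basis.

The given resolution need be neither minimal nor of finite rank. A vanishing Tor is therefore used
through chains with zero reduction, which involve only basis elements of smaller degree, and the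
structural claims follow by induction on the degree. -/

/-! ### The grading of the enveloping algebra and its augmentation. -/

section EnvelopingGrading

variable {k : Type u} [Field k] {𝔤 : Type v} [LieRing 𝔤] [LieAlgebra k 𝔤]
  (𝓰 : ℕ → Submodule k 𝔤)

open DirectSum

attribute [local instance 100] LieRing.ofAssociativeRing

instance envelopingGrading.gradedMonoid : SetLike.GradedMonoid (envelopingGrading 𝓰) where
  one_mem := Submodule.subset_span ⟨[], by simp, by simp, by simp⟩
  mul_mem i j a b ha hb := by
    refine Submodule.span_induction₂ (p := fun a b _ _ => a * b ∈ envelopingGrading 𝓰 (i + j))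
      ?_ ?_ ?_ ?_ ?_ ?_ ?_ ha hb
    · rintro _ _ ⟨l, hl, hls, rfl⟩ ⟨l', hl', hls', rfl⟩
      refine Submodule.subset_span ⟨l ++ l', ?_, by simp [hls, hls'], by simp⟩
      intro p hp
      rcases List.mem_append.1 hp with h | h
      exacts [hl p h, hl' p h]
    · simp
    · simp
    · intro x y z _ _ _ h h'
      rw [add_mul]; exact add_mem h h'
    · intro x y z _ _ _ h h'
      rw [mul_add]; exact add_mem h h'
    · intro r x y _ _ h
      rw [smul_mul_assoc]; exact Submodule.smul_mem _ _ h
    · intro r x y _ _ h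
      rw [mul_smul_comm]; exact Submodule.smul_mem _ _ h

variable {𝓰} in
theorem ι_mem_envelopingGrading {i : ℕ} {x : 𝔤} (hx : x ∈ 𝓰 i) :
    UniversalEnvelopingAlgebra.ι k x ∈ envelopingGrading 𝓰 (i : ℤ) :=
  Submodule.subset_span ⟨[(i, x)], by simpa using hx, by simp, by simp⟩

theorem of_envelopingGrading_congr {m n : ℤ} {a b : UniversalEnvelopingAlgebra k 𝔤}
    (ha : a ∈ envelopingGrading 𝓰 m) (hb : b ∈ envelopingGrading 𝓰 n) (h : m = n) (hab : a = b) :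
    of (fun n : ℤ => envelopingGrading 𝓰 n) m ⟨a, ha⟩ = of _ n ⟨b, hb⟩ := by
  subst h hab; rfl

theorem of_mul_of_envelopingGrading {m n p : ℤ} {a b : UniversalEnvelopingAlgebra k 𝔤}
    (ha : a ∈ envelopingGrading 𝓰 m) (hb : b ∈ envelopingGrading 𝓰 n)
    (hab : a * b ∈ envelopingGrading 𝓰 p) (h : m + n = p) :
    of (fun n : ℤ => envelopingGrading 𝓰 n) m ⟨a, ha⟩ *
      of (fun n : ℤ => envelopingGrading 𝓰 n) n ⟨b, hb⟩ =
      of (fun n : ℤ => envelopingGrading 𝓰 n) p ⟨a * b, hab⟩ := by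
  subst h
  exact of_mul_of _ _

section Decomposition

variable [GradedLieAlgebra 𝓰]

/-- The linear map `𝔤 → ⨁ n, U(𝔤)_n` which sends the elements of `𝔤_i` to degree `i`. -/
noncomputable def envelopingComponents : 𝔤 →ₗ[k] ⨁ n : ℤ, envelopingGrading 𝓰 n :=
  (toModule k ℕ (⨁ n : ℤ, envelopingGrading 𝓰 n) fun i =>
    lof k ℤ (fun n => envelopingGrading 𝓰 n) (i : ℤ) ∘ₗ
      ((UniversalEnvelopingAlgebra.ι k : 𝔤 →ₗ⁅k⁆ _) : 𝔤 →ₗ[k] _).restrict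
        fun _ hx => ι_mem_envelopingGrading hx) ∘ₗ (decomposeLinearEquiv 𝓰).toLinearMap

theorem envelopingComponents_of_mem {i : ℕ} {x : 𝔤} (hx : x ∈ 𝓰 i) :
    envelopingComponents 𝓰 x = of (fun n : ℤ => envelopingGrading 𝓰 n) (i : ℤ)
      ⟨UniversalEnvelopingAlgebra.ι k x, ι_mem_envelopingGrading hx⟩ := by
  simp only [envelopingComponents, LinearMap.comp_apply, LinearEquiv.coe_coe,
    decomposeLinearEquiv_apply, decompose_of_mem 𝓰 hx]
  rw [← lof_eq_of k, toModule_lof]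
  rfl

/-- By bilinearity only homogeneous arguments matter. For these, all terms lie in the single degree
`i + j`, where the identity is the defining relation of the enveloping algebra. -/
theorem envelopingComponents_lie (x y : 𝔤) :
    envelopingComponents 𝓰 ⁅x, y⁆ =
      envelopingComponents 𝓰 x * envelopingComponents 𝓰 y -
        envelopingComponents 𝓰 y * envelopingComponents 𝓰 x := by
  induction x using Decomposition.inductionOn 𝓰 with
  | zero => simp
  | add x x' h h' => simp only [add_lie, map_add, h, h', add_mul, mul_add]; abel
  | @homogeneous i x =>
    induction y using Decomposition.inductionOn 𝓰 with
    | zero => simp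
    | add y y' h h' => simp only [lie_add, map_add, h, h', add_mul, mul_add]; abel
    | @homogeneous j y =>
      have hxy : ⁅(x : 𝔤), (y : 𝔤)⁆ ∈ 𝓰 (i + j) :=
        SetLike.GradedBracket.bracket_mem x.2 y.2
      have hx := ι_mem_envelopingGrading x.2
      have hy := ι_mem_envelopingGrading y.2
      have h1 := SetLike.mul_mem_graded (A := envelopingGrading 𝓰) hx hy
      have h2 := SetLike.mul_mem_graded (A := envelopingGrading 𝓰) hy hx
      rw [← Nat.cast_add] at h1
      rw [← Nat.cast_add, add_comm] at h2
      rw [envelopingComponents_of_mem 𝓰 x.2, envelopingComponents_of_mem 𝓰 y.2,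
        envelopingComponents_of_mem 𝓰 hxy,
        of_mul_of_envelopingGrading 𝓰 hx hy h1 (by push_cast; ring),
        of_mul_of_envelopingGrading 𝓰 hy hx h2 (by push_cast; ring),
        eq_sub_iff_add_eq, ← map_add]
      refine of_envelopingGrading_congr 𝓰 _ _ rfl ?_
      simp only [LieHom.map_lie, LieRing.of_associative_ring_bracket]
      exact sub_add_cancel _ _

/-- The decomposition of `U(𝔤)` into homogeneous components, as an algebra map. -/
noncomputable def envelopingDecompose :
    UniversalEnvelopingAlgebra k 𝔤 →ₐ[k] ⨁ n : ℤ, envelopingGrading 𝓰 n :=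
  UniversalEnvelopingAlgebra.lift k
    { envelopingComponents 𝓰 with
      map_lie' := fun {x y} => envelopingComponents_lie 𝓰 x y }

theorem envelopingDecompose_ι (x : 𝔤) :
    envelopingDecompose 𝓰 (UniversalEnvelopingAlgebra.ι k x) = envelopingComponents 𝓰 x :=
  UniversalEnvelopingAlgebra.lift_ι_apply k _ x

/-- Directness of the sum comes from the universal property: the decomposition is an algebra map,
checked on Lie algebra elements in one direction and on monomials in the other. -/
noncomputable instance envelopingGrading.gradedAlgebra :
    GradedAlgebra (envelopingGrading 𝓰) :=
  GradedAlgebra.ofAlgHom _ (envelopingDecompose 𝓰)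
    (by
      apply UniversalEnvelopingAlgebra.hom_ext
      ext x
      change DirectSum.coeAlgHom _ (envelopingDecompose 𝓰 (UniversalEnvelopingAlgebra.ι k x)) =
        UniversalEnvelopingAlgebra.ι k x
      rw [envelopingDecompose_ι]
      induction x using Decomposition.inductionOn 𝓰 with
      | zero => simp
      | add x x' h h' => simp only [map_add, h, h']
      | homogeneous x => rw [envelopingComponents_of_mem 𝓰 x.2, DirectSum.coeAlgHom_of])
    (by
      rintro n ⟨a, ha⟩
      change envelopingDecompose 𝓰 a = _
      -- The degree is left as the sum over the list so that induction on the length of the monomial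
      -- applies; it is identified with `n` only afterwards.
      have key : ∀ l : List (ℕ × 𝔤), (∀ p ∈ l, p.2 ∈ 𝓰 p.1) →
          ∃ h, envelopingDecompose 𝓰 (l.map fun p => UniversalEnvelopingAlgebra.ι k p.2).prod =
            of (fun n : ℤ => envelopingGrading 𝓰 n) (l.map fun p => (p.1 : ℤ)).sum
              ⟨(l.map fun p => UniversalEnvelopingAlgebra.ι k p.2).prod, h⟩ := by
        intro l
        induction l with
        | nil => exact fun _ => ⟨SetLike.GradedOne.one_mem, by simp; rfl⟩
        | cons p l ih =>
          intro hl
          obtain ⟨h, e⟩ := ih fun q hq => hl q (List.mem_cons_of_mem _ hq)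
          have hp := hl p List.mem_cons_self
          refine ⟨by simpa using SetLike.mul_mem_graded (ι_mem_envelopingGrading hp) h, ?_⟩
          simp only [List.map_cons, List.prod_cons, map_mul, e, envelopingDecompose_ι,
            envelopingComponents_of_mem 𝓰 hp, of_mul_of]
          exact of_envelopingGrading_congr 𝓰 _ _ (by simp) rfl
      refine Submodule.span_induction (p := fun a h => envelopingDecompose 𝓰 a =
        of (fun n : ℤ => envelopingGrading 𝓰 n) n ⟨a, h⟩) ?_ ?_ ?_ ?_ ha
      · rintro _ ⟨l, hl, hln, rfl⟩
        obtain ⟨h, e⟩ := key l hl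
        rw [e]
        exact of_envelopingGrading_congr 𝓰 _ _ hln rfl
      · rw [map_zero]; exact (map_zero (of (fun n : ℤ => envelopingGrading 𝓰 n) n)).symm
      · intro x y hx hy ex ey
        rw [map_add, ex, ey, ← map_add]; rfl
      · intro c x hx ex
        rw [map_smul, ex, ← lof_eq_of k, ← lof_eq_of k, ← map_smul]; rfl)

end Decomposition

theorem sum_natCast_map_nonneg {α : Type*} (l : List (ℕ × α)) :
    0 ≤ (l.map fun p => (p.1 : ℤ)).sum := by
  refine List.sum_nonneg fun x hx => ?_
  obtain ⟨p, -, rfl⟩ := List.mem_map.1 hx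
  exact Int.natCast_nonneg _

theorem augmentation_ι (x : 𝔤) : augmentation k 𝔤 (UniversalEnvelopingAlgebra.ι k x) = 0 := by
  exact UniversalEnvelopingAlgebra.lift_ι_apply k (0 : 𝔤 →ₗ⁅k⁆ k) x

variable {𝓰}

theorem augmentation_eq_zero_of_mem {n : ℤ} (hn : n ≠ 0) {a : UniversalEnvelopingAlgebra k 𝔤}
    (ha : a ∈ envelopingGrading 𝓰 n) : augmentation k 𝔤 a = 0 := by
  have : envelopingGrading 𝓰 n ≤ LinearMap.ker (augmentation k 𝔤).toLinearMap := by
    refine Submodule.span_le.2 ?_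
    rintro _ ⟨l, hl, hln, rfl⟩
    cases l with
    | nil => exact absurd hln.symm hn
    | cons p l =>
      simp only [SetLike.mem_coe, LinearMap.mem_ker, AlgHom.toLinearMap_apply, List.map_cons,
        List.prod_cons, map_mul, augmentation_ι, zero_mul]
  exact this ha

theorem envelopingGrading_neg_eq_bot {n : ℤ} (hn : n < 0) : envelopingGrading 𝓰 n = ⊥ := by
  refine Submodule.span_eq_bot.2 ?_
  rintro _ ⟨l, hl, hln, rfl⟩
  have : 0 ≤ (l.map fun p => (p.1 : ℤ)).sum := sum_natCast_map_nonneg l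
  omega

theorem eq_zero_of_mem_neg {n : ℤ} (hn : n < 0) {a : UniversalEnvelopingAlgebra k 𝔤}
    (ha : a ∈ envelopingGrading 𝓰 n) : a = 0 := by
  rwa [envelopingGrading_neg_eq_bot hn, Submodule.mem_bot] at ha

/-- In a positive grading a nonzero monomial of degree `n` has all factors of positive degree. -/
theorem prod_eq_zero_or_forall_pos (h0 : 𝓰 0 = ⊥) (l : List (ℕ × 𝔤))
    (hl : ∀ p ∈ l, p.2 ∈ 𝓰 p.1) :
    (l.map fun p => UniversalEnvelopingAlgebra.ι k p.2).prod = 0 ∨ ∀ p ∈ l, 0 < p.1 := by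
  by_cases h : ∀ p ∈ l, 0 < p.1
  · exact Or.inr h
  · left
    push Not at h
    obtain ⟨p, hp, hp0⟩ := h
    have h1 := hl p hp
    rw [Nat.le_zero.1 hp0, h0, Submodule.mem_bot] at h1
    refine List.prod_eq_zero (List.mem_map.2 ⟨p, hp, ?_⟩)
    rw [h1, map_zero]

theorem envelopingGrading_zero_le (h0 : 𝓰 0 = ⊥) :
    envelopingGrading 𝓰 0 ≤ Submodule.span k {1} := by
  refine Submodule.span_le.2 ?_
  rintro _ ⟨l, hl, hln, rfl⟩
  rcases prod_eq_zero_or_forall_pos h0 l hl with h | h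
  · rw [h]; exact zero_mem _
  · cases l with
    | nil => exact Submodule.subset_span (by simp)
    | cons p l =>
      have h1 := h p List.mem_cons_self
      have : 0 ≤ (l.map fun p => (p.1 : ℤ)).sum := sum_natCast_map_nonneg l
      simp at hln
      omega

theorem exists_smul_one_of_mem_zero (h0 : 𝓰 0 = ⊥) {a : UniversalEnvelopingAlgebra k 𝔤}
    (ha : a ∈ envelopingGrading 𝓰 0) : ∃ c : k, a = c • 1 := by
  obtain ⟨c, hc⟩ := Submodule.mem_span_singleton.1 (envelopingGrading_zero_le h0 ha)
  exact ⟨c, hc.symm⟩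

theorem eq_zero_of_mem_zero_of_augmentation (h0 : 𝓰 0 = ⊥) {a : UniversalEnvelopingAlgebra k 𝔤}
    (ha : a ∈ envelopingGrading 𝓰 0) (h : augmentation k 𝔤 a = 0) : a = 0 := by
  obtain ⟨c, rfl⟩ := exists_smul_one_of_mem_zero h0 ha
  have : c = 0 := by simpa using h
  rw [this, zero_smul]

/-- A nonzero monomial of degree one whose factors have positive degrees has exactly one factor. -/
theorem exists_ι_of_mem_one (h0 : 𝓰 0 = ⊥) {a : UniversalEnvelopingAlgebra k 𝔤}
    (ha : a ∈ envelopingGrading 𝓰 1) : ∃ x ∈ 𝓰 1, UniversalEnvelopingAlgebra.ι k x = a := by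
  have : envelopingGrading 𝓰 1 ≤
      (𝓰 1).map ((UniversalEnvelopingAlgebra.ι k : 𝔤 →ₗ⁅k⁆ _) : 𝔤 →ₗ[k] _) := by
    refine Submodule.span_le.2 ?_
    rintro _ ⟨l, hl, hln, rfl⟩
    rcases prod_eq_zero_or_forall_pos h0 l hl with h | h
    · rw [h]; exact zero_mem _
    · match l with
      | [] => simp at hln
      | [p] =>
        have hp : p.1 = 1 := by simpa using hln
        have := hl p List.mem_cons_self
        rw [hp] at this
        exact ⟨p.2, this, by simp⟩
      | p :: q :: l =>
        have h1 := h p (by simp)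
        have h2 := h q (by simp)
        have : 0 ≤ (l.map fun p => (p.1 : ℤ)).sum := sum_natCast_map_nonneg l
        simp at hln
        omega
  exact this ha

/-- The augmentation ideal is homogeneous: the augmentation kills all nonzero degrees, so it sees
only the component of degree zero. -/
theorem augmentation_decompose [GradedLieAlgebra 𝓰] {a : UniversalEnvelopingAlgebra k 𝔤}
    (ha : augmentation k 𝔤 a = 0) (n : ℤ) :
    augmentation k 𝔤 (decompose (envelopingGrading 𝓰) a n) = 0 := by
  classical
  by_cases hn : n = 0
  · subst hn
    rw [← ha]
    conv_rhs => rw [← sum_support_decompose (envelopingGrading 𝓰) a, map_sum]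
    by_cases h : (0 : ℤ) ∈ (decompose (envelopingGrading 𝓰) a).support
    · rw [Finset.sum_eq_single_of_mem 0 h]
      exact fun m _ hm => augmentation_eq_zero_of_mem hm (SetLike.coe_mem _)
    · rw [DFinsupp.notMem_support_iff.1 h, Finset.sum_eq_zero]
      · simp
      · intro m hm
        exact augmentation_eq_zero_of_mem (fun e => h (e ▸ hm)) (SetLike.coe_mem _)
  · exact augmentation_eq_zero_of_mem hn (SetLike.coe_mem _)

end EnvelopingGrading

section GradedMaps

open DirectSum

/-- A homogeneous map of degree zero commutes with taking homogeneous components. -/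
theorem DirectSum.decompose_map_of_homogeneous {ι N P σ τ F : Type*} [DecidableEq ι]
    [AddCommMonoid N] [AddCommMonoid P] [SetLike σ N] [SetLike τ P] [AddSubmonoidClass σ N]
    [AddSubmonoidClass τ P] (𝒩 : ι → σ) (𝒬 : ι → τ) [Decomposition 𝒩] [Decomposition 𝒬]
    [FunLike F N P] [AddMonoidHomClass F N P] (φ : F) (hφ : ∀ j, ∀ x ∈ 𝒩 j, φ x ∈ 𝒬 j)
    (x : N) (j : ι) :
    (decompose 𝒬 (φ x) j : P) = φ (decompose 𝒩 x j) := by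
  induction x using Decomposition.inductionOn 𝒩 with
  | zero => simp
  | add x y hx hy => simp [hx, hy]
  | @homogeneous i x =>
    by_cases h : i = j
    · subst h
      rw [decompose_of_mem_same 𝒬 (hφ i _ x.2), decompose_of_mem_same 𝒩 x.2]
    · rw [decompose_of_mem_ne 𝒬 (hφ i _ x.2) h, decompose_of_mem_ne 𝒩 x.2 h, map_zero]

end GradedMaps

/-! ### Graded free modules and their reduction modulo the augmentation ideal. -/

section FreeModules

open DirectSum

variable {k : Type u} [Field k] {𝔤 : Type v} [LieRing 𝔤] [LieAlgebra k 𝔤]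
  {𝓰 : ℕ → Submodule k 𝔤} {α κ : Type*} {δ : α → ℤ}

theorem single_mem_freeGrading {x : α} {n j : ℤ} {a : UniversalEnvelopingAlgebra k 𝔤}
    (ha : a ∈ envelopingGrading 𝓰 n) (h : n + δ x = j) :
    Finsupp.single x a ∈ freeGrading 𝓰 δ j := by
  classical
  intro y
  by_cases hy : x = y
  · subst hy
    rw [Finsupp.single_eq_same, ← h, add_sub_cancel_right]
    exact ha
  · rw [Finsupp.single_eq_of_ne' hy]
    exact zero_mem _

theorem basis_mem_freeGrading (x : α) :
    Finsupp.single x (1 : UniversalEnvelopingAlgebra k 𝔤) ∈ freeGrading 𝓰 δ (δ x) :=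
  single_mem_freeGrading (n := 0) (SetLike.GradedOne.one_mem) (zero_add _)

section

variable [GradedLieAlgebra 𝓰]

/-- The decomposition of a graded free module into homogeneous components. -/
noncomputable def freeDecompose (𝓰 : ℕ → Submodule k 𝔤) [GradedLieAlgebra 𝓰] (δ : α → ℤ) :
    (α →₀ UniversalEnvelopingAlgebra k 𝔤) →+ ⨁ j, freeGrading 𝓰 δ j :=
  Finsupp.liftAddHom fun x =>
    (toAddMonoid fun n : ℤ => (of (fun j => freeGrading 𝓰 δ j) (n + δ x)).comp
      (AddMonoidHom.codRestrict
        ((Finsupp.singleAddHom x).comp (envelopingGrading 𝓰 n).subtype.toAddMonoidHom)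
        (freeGrading 𝓰 δ (n + δ x)) fun a => single_mem_freeGrading a.2 rfl)).comp
    (decomposeAddEquiv (envelopingGrading 𝓰)).toAddMonoidHom

theorem freeDecompose_single {x : α} {n j : ℤ} {a : UniversalEnvelopingAlgebra k 𝔤}
    (ha : a ∈ envelopingGrading 𝓰 n) (h : n + δ x = j) :
    freeDecompose 𝓰 δ (Finsupp.single x a) =
      of (fun j => freeGrading 𝓰 δ j) j ⟨_, single_mem_freeGrading ha h⟩ := by
  subst h
  simp only [freeDecompose, Finsupp.liftAddHom_apply_single, AddMonoidHom.comp_apply,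
    AddEquiv.coe_toAddMonoidHom, decomposeAddEquiv_apply,
    decompose_of_mem (envelopingGrading 𝓰) ha, toAddMonoid_of]
  rfl

noncomputable instance freeGrading.decomposition (δ : α → ℤ) :
    Decomposition (freeGrading 𝓰 δ) :=
  Decomposition.ofAddHom _ (freeDecompose 𝓰 δ)
    (by
      refine Finsupp.addHom_ext fun x a => ?_
      induction a using Decomposition.inductionOn (envelopingGrading 𝓰) with
      | zero => simp
      | add a b ha hb => simp only [Finsupp.single_add, map_add, ha, hb]
      | homogeneous a =>
        rw [AddMonoidHom.comp_apply, freeDecompose_single a.2 rfl, coeAddMonoidHom_of]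
        rfl)
    (by
      refine DirectSum.addHom_ext fun j f => ?_
      rw [AddMonoidHom.comp_apply, coeAddMonoidHom_of, AddMonoidHom.id_apply]
      obtain ⟨f, hf⟩ := f
      -- A homogeneous `f` is the sum of its coordinate terms, each again homogeneous of degree `j`.
      -- The induction runs over partial sums and is then applied to the support.
      have : ∀ s : Finset α, ∃ h, freeDecompose 𝓰 δ (∑ x ∈ s, Finsupp.single x (f x)) =
          of (fun j => freeGrading 𝓰 δ j) j ⟨∑ x ∈ s, Finsupp.single x (f x), h⟩ := by
        classical
        intro s
        induction s using Finset.induction_on with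
        | empty =>
          refine ⟨by rw [Finset.sum_empty]; exact zero_mem _, ?_⟩
          simp only [Finset.sum_empty]
          rw [map_zero]
          exact (map_zero _).symm
        | insert x s hx ih =>
          obtain ⟨h, e⟩ := ih
          have hxm := single_mem_freeGrading (hf x) (sub_add_cancel j (δ x))
          refine ⟨by rw [Finset.sum_insert hx]; exact add_mem hxm h, ?_⟩
          simp only [Finset.sum_insert hx]
          rw [map_add, e, freeDecompose_single (hf x) (sub_add_cancel j (δ x)), ← map_add]
          rfl
      obtain ⟨h, e⟩ := this f.support
      have hs : ∑ x ∈ f.support, Finsupp.single x (f x) = f := Finsupp.sum_single f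
      simp only [hs] at e
      exact e)

theorem decompose_freeGrading_apply (f : α →₀ UniversalEnvelopingAlgebra k 𝔤) (j : ℤ) (x : α) :
    (decompose (freeGrading 𝓰 δ) f j : α →₀ UniversalEnvelopingAlgebra k 𝔤) x =
      decompose (envelopingGrading 𝓰) (f x) (j - δ x) := by
  induction f using Decomposition.inductionOn (freeGrading 𝓰 δ) with
  | zero => simp
  | add f g hf hg => simp [hf, hg]
  | @homogeneous i f =>
    by_cases h : i = j
    · subst h
      rw [decompose_of_mem_same _ f.2, decompose_of_mem_same _ (f.2 x)]
    · rw [decompose_of_mem_ne _ f.2 h, decompose_of_mem_ne _ (f.2 x) (by omega)]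
      rfl

end

/-- The reduction `U(𝔤)^(α) → k^(α)` modulo the augmentation ideal. -/
noncomputable def reduction (k : Type u) [Field k] (𝔤 : Type v) [LieRing 𝔤] [LieAlgebra k 𝔤]
    (α : Type*) : (α →₀ UniversalEnvelopingAlgebra k 𝔤) →ₗ[k] (α →₀ k) :=
  Finsupp.mapRange.linearMap (augmentation k 𝔤).toLinearMap

@[simp]
theorem reduction_apply (f : α →₀ UniversalEnvelopingAlgebra k 𝔤) (x : α) :
    reduction k 𝔤 α f x = augmentation k 𝔤 (f x) := rfl

theorem reduction_eq_zero_iff {f : α →₀ UniversalEnvelopingAlgebra k 𝔤} :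
    reduction k 𝔤 α f = 0 ↔ ∀ x, augmentation k 𝔤 (f x) = 0 :=
  DFunLike.ext_iff

theorem reduction_smul (a : UniversalEnvelopingAlgebra k 𝔤)
    (f : α →₀ UniversalEnvelopingAlgebra k 𝔤) :
    reduction k 𝔤 α (a • f) = augmentation k 𝔤 a • reduction k 𝔤 α f := by
  ext x; simp

theorem reduction_single (x : α) (a : UniversalEnvelopingAlgebra k 𝔤) :
    reduction k 𝔤 α (Finsupp.single x a) = Finsupp.single x (augmentation k 𝔤 a) :=
  Finsupp.mapRange_single (hf := map_zero _)

/-- Multiplicativity of the augmentation makes reduction compatible with linear maps. This links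
chains of a resolution with the complex that computes Tor. -/
theorem reduction_map (φ : (α →₀ UniversalEnvelopingAlgebra k 𝔤) →ₗ[UniversalEnvelopingAlgebra k 𝔤]
    (κ →₀ UniversalEnvelopingAlgebra k 𝔤)) (f : α →₀ UniversalEnvelopingAlgebra k 𝔤) :
    reduction k 𝔤 κ (φ f) = tensorTrivial φ (reduction k 𝔤 α f) := by
  induction f using Finsupp.induction_linear with
  | zero => simp
  | add f g hf hg => simp only [map_add, hf, hg]
  | single x a =>
    have : Finsupp.single x a = a • Finsupp.single x (1 : UniversalEnvelopingAlgebra k 𝔤) := by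
      simp
    rw [reduction_single, tensorTrivial, Finsupp.linearCombination_single, this, map_smul,
      reduction_smul]
    rfl

theorem reduction_map_eq_zero
    (φ : (α →₀ UniversalEnvelopingAlgebra k 𝔤) →ₗ[UniversalEnvelopingAlgebra k 𝔤]
      (κ →₀ UniversalEnvelopingAlgebra k 𝔤)) {f : α →₀ UniversalEnvelopingAlgebra k 𝔤}
    (hf : reduction k 𝔤 α f = 0) : reduction k 𝔤 κ (φ f) = 0 := by
  rw [reduction_map, hf, map_zero]

/-- The section `k^(α) → U(𝔤)^(α)` of the reduction. -/
noncomputable def constants (k : Type u) [Field k] (𝔤 : Type v) [LieRing 𝔤] [LieAlgebra k 𝔤]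
    (α : Type*) : (α →₀ k) →ₗ[k] (α →₀ UniversalEnvelopingAlgebra k 𝔤) :=
  Finsupp.mapRange.linearMap (Algebra.linearMap k (UniversalEnvelopingAlgebra k 𝔤))

@[simp]
theorem constants_apply (c : α →₀ k) (x : α) :
    constants k 𝔤 α c x = algebraMap k (UniversalEnvelopingAlgebra k 𝔤) (c x) := rfl

@[simp]
theorem reduction_constants (c : α →₀ k) : reduction k 𝔤 α (constants k 𝔤 α c) = c := by
  ext x; simp

theorem constants_mem {c : α →₀ k} {j : ℤ} (hc : c ∈ Finsupp.supported k k {x | δ x = j}) :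
    constants k 𝔤 α c ∈ freeGrading 𝓰 δ j := by
  intro x
  by_cases hx : δ x = j
  · rw [← hx, sub_self, constants_apply, Algebra.algebraMap_eq_smul_one]
    exact Submodule.smul_mem _ _ SetLike.GradedOne.one_mem
  · have : c x = 0 := by
      by_contra h
      exact hx ((Finsupp.mem_supported k c).1 hc (Finsupp.mem_support_iff.2 h))
    rw [constants_apply, this, map_zero]
    exact zero_mem _

theorem reduction_mem_supported {f : α →₀ UniversalEnvelopingAlgebra k 𝔤} {j : ℤ}
    (hf : f ∈ freeGrading 𝓰 δ j) :
    reduction k 𝔤 α f ∈ Finsupp.supported k k {x | δ x = j} := by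
  refine (Finsupp.mem_supported k _).2 fun x hx => ?_
  by_contra h
  refine Finsupp.mem_support_iff.1 hx (augmentation_eq_zero_of_mem ?_ (hf x))
  rw [Set.mem_ofPred_eq] at h
  omega

theorem reduction_decompose [GradedLieAlgebra 𝓰] {f : α →₀ UniversalEnvelopingAlgebra k 𝔤}
    (hf : reduction k 𝔤 α f = 0) (j : ℤ) :
    reduction k 𝔤 α (decompose (freeGrading 𝓰 δ) f j) = 0 := by
  rw [reduction_eq_zero_iff] at hf ⊢
  intro x
  rw [decompose_freeGrading_apply]
  exact augmentation_decompose (hf x) _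

/-- A homogeneous element of degree `j` in the augmentation ideal times a free module only involves
basis elements of degree less than `j`. -/
theorem map_mem_of_reduction_eq_zero (h0 : 𝓰 0 = ⊥) {N : Type*} [AddCommGroup N]
    [Module (UniversalEnvelopingAlgebra k 𝔤) N]
    (φ : (α →₀ UniversalEnvelopingAlgebra k 𝔤) →ₗ[UniversalEnvelopingAlgebra k 𝔤] N)
    (S : Submodule (UniversalEnvelopingAlgebra k 𝔤) N) {j : ℤ}
    {f : α →₀ UniversalEnvelopingAlgebra k 𝔤} (hf : f ∈ freeGrading 𝓰 δ j)
    (hred : reduction k 𝔤 α f = 0) (hS : ∀ x, δ x < j → φ (Finsupp.single x 1) ∈ S) :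
    φ f ∈ S := by
  rw [← Finsupp.sum_single f, Finsupp.sum, map_sum]
  refine sum_mem fun x _ => ?_
  have e : Finsupp.single x (f x) =
      f x • Finsupp.single x (1 : UniversalEnvelopingAlgebra k 𝔤) := by simp
  rw [e, map_smul]
  rcases lt_trichotomy (δ x) j with h | h | h
  · exact S.smul_mem _ (hS x h)
  -- A coefficient of degree zero is a scalar, and a scalar with zero augmentation vanishes.
  · have hx := hf x
    rw [h, sub_self] at hx
    rw [eq_zero_of_mem_zero_of_augmentation h0 hx (reduction_eq_zero_iff.1 hred x), zero_smul]
    exact S.zero_mem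
  · rw [eq_zero_of_mem_neg (by omega) (hf x), zero_smul]
    exact S.zero_mem

end FreeModules

theorem Int.induction_of_bounded_below {P : ℤ → Prop} (B : ℤ) (hB : ∀ j < B, P j)
    (h : ∀ j, (∀ i < j, P i) → P j) (j : ℤ) : P j := by
  have : ∀ n : ℕ, ∀ j < B + n, P j := by
    intro n
    induction n with
    | zero => simpa using hB
    | succ n ih => exact fun j hj => h j fun i hi => ih i (by push_cast at hj; omega)
  exact this (j - B + 1).toNat j (by omega)

section GradedModules

open DirectSum

variable {k : Type u} [Field k] {𝔤 : Type v} [LieRing 𝔤] [LieAlgebra k 𝔤]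
  {𝓰 : ℕ → Submodule k 𝔤}

instance freeGrading.gradedSMul {α : Type*} (δ : α → ℤ) :
    SetLike.GradedSMul (envelopingGrading 𝓰) (freeGrading 𝓰 δ) where
  smul_mem {i j a f} ha hf x := by
    rw [Finsupp.smul_apply, smul_eq_mul, vadd_eq_add, add_sub_assoc]
    exact SetLike.mul_mem_graded ha (hf x)

/-- A linear map out of a graded free module is homogeneous if it is so on the basis. -/
theorem map_mem_of_basis {α N : Type*} {δ : α → ℤ} [AddCommGroup N] [Module k N]
    [Module (UniversalEnvelopingAlgebra k 𝔤) N] (𝒩 : ℤ → Submodule k N)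
    [SetLike.GradedSMul (envelopingGrading 𝓰) 𝒩]
    (φ : (α →₀ UniversalEnvelopingAlgebra k 𝔤) →ₗ[UniversalEnvelopingAlgebra k 𝔤] N)
    (hφ : ∀ x, φ (Finsupp.single x 1) ∈ 𝒩 (δ x)) (j : ℤ) :
    ∀ f ∈ freeGrading 𝓰 δ j, φ f ∈ 𝒩 j := by
  intro f hf
  rw [← Finsupp.sum_single f, Finsupp.sum, map_sum]
  refine sum_mem fun x _ => ?_
  have e : Finsupp.single x (f x) =
      f x • Finsupp.single x (1 : UniversalEnvelopingAlgebra k 𝔤) := by simp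
  have := SetLike.GradedSMul.smul_mem (A := envelopingGrading 𝓰) (B := 𝒩) (hf x) (hφ x)
  rwa [vadd_eq_add, sub_add_cancel, ← map_smul, ← e] at this

end GradedModules

theorem Submodule.mem_of_map_mkQ_eq_bot {R M : Type*} [Ring R] [AddCommGroup M] [Module R M]
    {Z B : Submodule R M} (h : Z.map B.mkQ = ⊥) {c : M} (hc : c ∈ Z) : c ∈ B := by
  have h1 : B.mkQ c ∈ Z.map B.mkQ := Submodule.mem_map_of_mem hc
  rw [h, Submodule.mem_bot] at h1
  exact (Submodule.Quotient.mk_eq_zero B).1 h1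

/-- Two maps with the same kernel on a subspace have images of that subspace of the same
dimension. -/
theorem Submodule.finrank_map_eq_of_ker_eq {K V W W' : Type*} [Field K] [AddCommGroup V]
    [Module K V] [AddCommGroup W] [Module K W] [AddCommGroup W'] [Module K W']
    (Z : Submodule K V) (f : V →ₗ[K] W) (g : V →ₗ[K] W') (h : ∀ c ∈ Z, f c = 0 ↔ g c = 0) :
    Module.finrank K (Z.map f) = Module.finrank K (Z.map g) := by
  have hker : LinearMap.ker (f.domRestrict Z) = LinearMap.ker (g.domRestrict Z) := by
    ext c
    simpa using h c c.2
  rw [← LinearMap.range_domRestrict, ← LinearMap.range_domRestrict]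
  exact ((f.domRestrict Z).quotKerEquivRange.symm.trans
    ((Submodule.quotEquivOfEq _ _ hker).trans (g.domRestrict Z).quotKerEquivRange)).finrank_eq

/-! ### Consequences of vanishing Tor; a graded Nakayama argument. -/

namespace GradedFreeResolution

open DirectSum

variable {k : Type u} [Field k] {𝔤 : Type v} [LieRing 𝔤] [LieAlgebra k 𝔤]
  {𝓰 : ℕ → Submodule k 𝔤} {M : Type w} [AddCommGroup M] [Module k M]
  [Module (UniversalEnvelopingAlgebra k 𝔤) M] {𝓜 : ℤ → Submodule k M}
  (F : GradedFreeResolution 𝓰 𝓜)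

theorem d_d (i : ℕ) (f : F.ι (i + 2) →₀ UniversalEnvelopingAlgebra k 𝔤) :
    F.d i (F.d (i + 1) f) = 0 :=
  (F.exact i _).2 ⟨f, rfl⟩

theorem ε_d (f : F.ι 1 →₀ UniversalEnvelopingAlgebra k 𝔤) : F.ε (F.d 0 f) = 0 :=
  (F.exact_zero _).2 ⟨f, rfl⟩

theorem mem_boundaries_of_rank_eq_zero {i : ℕ} {j : ℤ} (h : Module.rank k (F.Tor i j) = 0)
    {c : F.ι i →₀ k} (hc : c ∈ F.cyclesOfDegree i j) : c ∈ F.boundaries i :=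
  Submodule.mem_of_map_mkQ_eq_bot (Submodule.rank_eq_zero.1 h) hc

theorem reduction_d_mem_boundaries {i : ℕ} (g : F.ι (i + 1) →₀ UniversalEnvelopingAlgebra k 𝔤) :
    reduction k 𝔤 _ (F.d i g) ∈ F.boundaries i :=
  ⟨reduction k 𝔤 _ g, (reduction_map _ _).symm⟩

variable [GradedLieAlgebra 𝓰]

theorem decompose_d (i : ℕ) (f : F.ι (i + 1) →₀ UniversalEnvelopingAlgebra k 𝔤) (j : ℤ) :
    (decompose (freeGrading 𝓰 (F.δ i)) (F.d i f) j : F.ι i →₀ UniversalEnvelopingAlgebra k 𝔤) =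
      F.d i (decompose (freeGrading 𝓰 (F.δ (i + 1))) f j) :=
  decompose_map_of_homogeneous _ _ _ (F.d_homogeneous i) f j

theorem decompose_ε [Decomposition 𝓜] (f : F.ι 0 →₀ UniversalEnvelopingAlgebra k 𝔤) (j : ℤ) :
    (decompose 𝓜 (F.ε f) j : M) = F.ε (decompose (freeGrading 𝓰 (F.δ 0)) f j) :=
  decompose_map_of_homogeneous _ _ _ F.ε_homogeneous f j

theorem exists_ε_eq [Decomposition 𝓜] {j : ℤ} {m : M} (hm : m ∈ 𝓜 j) :
    ∃ f ∈ freeGrading 𝓰 (F.δ 0) j, F.ε f = m := by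
  obtain ⟨f, rfl⟩ := F.ε_surjective m
  refine ⟨decompose (freeGrading 𝓰 (F.δ 0)) f j, SetLike.coe_mem _, ?_⟩
  rw [← F.decompose_ε, decompose_of_mem_same _ hm]

theorem exists_d_eq {i : ℕ} {j : ℤ} {f : F.ι i →₀ UniversalEnvelopingAlgebra k 𝔤}
    (hf : f ∈ freeGrading 𝓰 (F.δ i) j) (hr : f ∈ Set.range (F.d i)) :
    ∃ g ∈ freeGrading 𝓰 (F.δ (i + 1)) j, F.d i g = f := by
  obtain ⟨g, rfl⟩ := hr
  refine ⟨decompose (freeGrading 𝓰 (F.δ (i + 1))) g j, SetLike.coe_mem _, ?_⟩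
  rw [← F.decompose_d, decompose_of_mem_same _ hf]

/-- A homogeneous chain whose reduction is a boundary is congruent, modulo boundaries, to a
homogeneous chain with reduction zero. -/
theorem exists_reduction_eq_zero {i : ℕ} {j : ℤ} {f : F.ι i →₀ UniversalEnvelopingAlgebra k 𝔤}
    (hf : f ∈ freeGrading 𝓰 (F.δ i) j) (hb : reduction k 𝔤 _ f ∈ F.boundaries i) :
    ∃ f' ∈ freeGrading 𝓰 (F.δ i) j, reduction k 𝔤 _ f' = 0 ∧ ∃ g, f - F.d i g = f' := by
  obtain ⟨c, hc⟩ := hb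
  -- The preimage `c` of the boundary need not be homogeneous, so the correction is made first and
  -- the component of degree `j` is taken afterwards.
  have h : reduction k 𝔤 _ (f - F.d i (constants k 𝔤 _ c)) = 0 := by
    rw [map_sub, reduction_map, reduction_constants, hc, sub_self]
  refine ⟨_, SetLike.coe_mem _, reduction_decompose (δ := F.δ i) h j,
    decompose (freeGrading 𝓰 (F.δ (i + 1))) (constants k 𝔤 _ c) j, ?_⟩
  rw [← F.decompose_d, decompose_sub]
  conv_lhs => rw [← decompose_of_mem_same _ hf]
  rfl

theorem exists_ε_eq_of_rank_eq_zero [Decomposition 𝓜] {j : ℤ}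
    (h : Module.rank k (F.Tor 0 j) = 0) {m : M} (hm : m ∈ 𝓜 j) :
    ∃ f ∈ freeGrading 𝓰 (F.δ 0) j, reduction k 𝔤 _ f = 0 ∧ F.ε f = m := by
  obtain ⟨f, hf, rfl⟩ := F.exists_ε_eq hm
  obtain ⟨f', hf', h', g, hg⟩ := F.exists_reduction_eq_zero hf
    (F.mem_boundaries_of_rank_eq_zero h ⟨Submodule.mem_top, reduction_mem_supported hf⟩)
  exact ⟨f', hf', h', by rw [← hg, map_sub, F.ε_d, sub_zero]⟩

/-- The reduction of any homogeneous preimage is a cycle, hence a boundary when Tor vanishes;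
subtracting a differential makes it zero without changing the image. Together with
`map_mem_of_reduction_eq_zero`, this is how zero entries of the table feed inductions on the degree.
-/
theorem exists_d_eq_of_rank_eq_zero {i : ℕ} {j : ℤ}
    (h : Module.rank k (F.Tor (i + 1) j) = 0) {f : F.ι i →₀ UniversalEnvelopingAlgebra k 𝔤}
    (hf : f ∈ freeGrading 𝓰 (F.δ i) j) (hr : f ∈ Set.range (F.d i))
    (hred : reduction k 𝔤 _ f = 0) :
    ∃ g ∈ freeGrading 𝓰 (F.δ (i + 1)) j, reduction k 𝔤 _ g = 0 ∧ F.d i g = f := by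
  obtain ⟨g, hg, rfl⟩ := F.exists_d_eq hf hr
  rw [reduction_map] at hred
  obtain ⟨g', hg', h', e, he⟩ := F.exists_reduction_eq_zero hg
    (F.mem_boundaries_of_rank_eq_zero h ⟨hred, reduction_mem_supported hg⟩)
  exact ⟨g', hg', h', by rw [← he, map_sub, F.d_d, sub_zero]⟩

/-- A finitely generated graded module over `U(𝔤)` is bounded below. -/
theorem exists_lower_bound (F : GradedFreeResolution 𝓰 𝓜) [Decomposition 𝓜]
    [Module.Finite (UniversalEnvelopingAlgebra k 𝔤) M] :
    ∃ B : ℤ, ∀ j < B, ∀ m ∈ 𝓜 j, m = 0 := by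
  classical
  obtain ⟨t, ht⟩ := Module.Finite.fg_top (R := UniversalEnvelopingAlgebra k 𝔤) (M := M)
  choose s hs using F.ε_surjective
  let S : Finset (F.ι 0) := t.biUnion fun m => (s m).support
  -- The basis `ι 0` may be infinite, but lifts of finitely many module generators involve only a
  -- finite set `S` of basis elements, which suffices to reach all of `M`.
  have hS : ∀ m, ∃ f, f.support ⊆ S ∧ F.ε f = m := by
    have : (⊤ : Submodule (UniversalEnvelopingAlgebra k 𝔤) M) ≤
        (Finsupp.supported (UniversalEnvelopingAlgebra k 𝔤) (UniversalEnvelopingAlgebra k 𝔤)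
          (S : Set (F.ι 0))).map F.ε := by
      rw [← ht, Submodule.span_le]
      intro m hm
      refine ⟨s m, (Finsupp.mem_supported _ _).2 ?_, hs m⟩
      exact_mod_cast Finset.subset_biUnion_of_mem (fun m => (s m).support) hm
    intro m
    obtain ⟨f, hf, rfl⟩ := this (Submodule.mem_top (x := m))
    exact ⟨f, by exact_mod_cast (Finsupp.mem_supported _ _).1 hf, rfl⟩
  obtain ⟨B, hB⟩ := (S.image (F.δ 0)).bddBelow
  refine ⟨B, fun j hj m hm => ?_⟩
  obtain ⟨f, hf, rfl⟩ := hS m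
  rw [← decompose_of_mem_same 𝓜 hm, F.decompose_ε]
  have : (decompose (freeGrading 𝓰 (F.δ 0)) f j :
      F.ι 0 →₀ UniversalEnvelopingAlgebra k 𝔤) = 0 := by
    ext x
    rw [decompose_freeGrading_apply]
    by_cases hx : x ∈ S
    · have h1 : B ≤ F.δ 0 x := hB (Finset.mem_coe.2 (Finset.mem_image_of_mem _ hx))
      exact eq_zero_of_mem_neg (by omega) (SetLike.coe_mem _)
    · rw [Finsupp.notMem_support_iff.1 fun h => hx (hf h), decompose_zero]
      rfl
  rw [this, map_zero]

/-- If `Tor_0` is one-dimensional and concentrated in degree zero, then a finitely generated module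
is generated by one element of degree zero. -/
theorem exists_generator [Decomposition 𝓜] [IsScalarTower k (UniversalEnvelopingAlgebra k 𝔤) M]
    [Module.Finite (UniversalEnvelopingAlgebra k 𝔤) M] (h0 : 𝓰 0 = ⊥)
    (hTor : Module.rank k (F.Tor 0 0) = 1)
    (hTor' : ∀ j ≠ 0, Module.rank k (F.Tor 0 j) = 0) :
    ∃ m ∈ 𝓜 0, m ≠ 0 ∧ Submodule.span (UniversalEnvelopingAlgebra k 𝔤) {m} = ⊤ := by
  obtain ⟨⟨v, hv⟩, hv0, hspan⟩ := (finrank_eq_one_iff' (K := k) (V := F.Tor 0 0)).1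
    (Module.finrank_eq_of_rank_eq (n := 1) (by simpa using hTor))
  obtain ⟨c, hc, rfl⟩ := hv
  have hcb : c ∉ F.boundaries 0 := fun h => hv0 (by
    ext
    exact (Submodule.Quotient.mk_eq_zero _).2 h)
  have hεk (a : k) (f : F.ι 0 →₀ UniversalEnvelopingAlgebra k 𝔤) : F.ε (a • f) = a • F.ε f := by
    rw [← algebraMap_smul (UniversalEnvelopingAlgebra k 𝔤) a f, map_smul, algebraMap_smul]
  have hc0 : constants k 𝔤 _ c ∈ freeGrading 𝓰 (F.δ 0) 0 := constants_mem hc.2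
  refine ⟨F.ε (constants k 𝔤 _ c), F.ε_homogeneous 0 _ hc0, ?_, ?_⟩
  -- If the image were zero, exactness would make the lift of `c` a differential, and `c` itself a
  -- boundary.
  · intro h
    obtain ⟨g, hg⟩ := (F.exact_zero _).1 h
    apply hcb
    rw [← reduction_constants (𝔤 := 𝔤) c, ← hg]
    exact F.reduction_d_mem_boundaries g
  set S := Submodule.span (UniversalEnvelopingAlgebra k 𝔤) {F.ε (constants k 𝔤 _ c)} with hS
  have hm0 : F.ε (constants k 𝔤 _ c) ∈ S := Submodule.mem_span_singleton_self _
  obtain ⟨B, hB⟩ := F.exists_lower_bound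
  have hle : ∀ j, ∀ m ∈ 𝓜 j, m ∈ S := by
    refine Int.induction_of_bounded_below B (fun j hj m hm => ?_) fun j ih m hm => ?_
    · rw [hB j hj m hm]; exact zero_mem _
    · have key : ∀ f ∈ freeGrading 𝓰 (F.δ 0) j, reduction k 𝔤 _ f = 0 → F.ε f ∈ S :=
        fun f hf hred => map_mem_of_reduction_eq_zero h0 F.ε S hf hred fun x hx =>
          ih _ hx _ (F.ε_homogeneous _ _ (basis_mem_freeGrading x))
      by_cases hj : j = 0
      · subst hj
        obtain ⟨f, hf, rfl⟩ := F.exists_ε_eq hm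
        have hfc : reduction k 𝔤 _ f ∈ F.cyclesOfDegree 0 0 :=
          ⟨Submodule.mem_top, reduction_mem_supported hf⟩
        -- In degree zero, the class of `c` spans Tor, so `f` is a multiple of the lift of `c` up to
        -- a boundary and a chain with zero reduction.
        obtain ⟨a, ha⟩ := hspan ⟨_, Submodule.mem_map_of_mem hfc⟩
        have hb : reduction k 𝔤 _ (f - a • constants k 𝔤 _ c) ∈ F.boundaries 0 := by
          rw [map_sub, map_smul, reduction_constants, ← Submodule.ker_mkQ (F.boundaries 0),
            LinearMap.mem_ker, map_sub, map_smul, sub_eq_zero]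
          exact (congrArg Subtype.val ha).symm
        obtain ⟨f', hf', hred, g, hg⟩ := F.exists_reduction_eq_zero
          (sub_mem hf (Submodule.smul_mem _ a hc0)) hb
        have e : F.ε f = F.ε f' + a • F.ε (constants k 𝔤 _ c) := by
          rw [← hg, map_sub, map_sub, F.ε_d, hεk]; abel
        rw [e]
        refine add_mem (key f' hf' hred) ?_
        rw [← algebraMap_smul (UniversalEnvelopingAlgebra k 𝔤) a]
        exact S.smul_mem _ hm0
      · obtain ⟨f, hf, hred, rfl⟩ := F.exists_ε_eq_of_rank_eq_zero (hTor' j hj) hm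
        exact key f hf hred
  rw [eq_top_iff]
  intro m _
  classical
  rw [← sum_support_decompose 𝓜 m]
  exact sum_mem fun j _ => hle j _ (SetLike.coe_mem _)

end GradedFreeResolution

/-! ### The annihilator of a generator in low degrees. -/

section Annihilator

variable {k : Type u} [Field k] {𝔤 : Type v} [LieRing 𝔤] [LieAlgebra k 𝔤]
  {𝓰 : ℕ → Submodule k 𝔤} {M : Type w} [AddCommGroup M]
  [Module (UniversalEnvelopingAlgebra k 𝔤) M] {m₀ : M}

/-- The part of degree `j` of the annihilator of `m₀`. -/
def annihilatorOfDegree (𝓰 : ℕ → Submodule k 𝔤) (m₀ : M) (j : ℤ) :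
    Submodule k (UniversalEnvelopingAlgebra k 𝔤) :=
  envelopingGrading 𝓰 j ⊓ (LinearMap.ker (LinearMap.toSpanSingleton
    (UniversalEnvelopingAlgebra k 𝔤) M m₀)).restrictScalars k

theorem eq_zero_of_mem_zero_of_smul [Module k M]
    [IsScalarTower k (UniversalEnvelopingAlgebra k 𝔤) M]
    (h0 : 𝓰 0 = ⊥) (hm₀ : m₀ ≠ 0) {a : UniversalEnvelopingAlgebra k 𝔤}
    (ha : a ∈ envelopingGrading 𝓰 0) (h : a • m₀ = 0) : a = 0 := by
  obtain ⟨c, rfl⟩ := exists_smul_one_of_mem_zero h0 ha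
  rw [smul_assoc, one_smul] at h
  rw [(smul_eq_zero.1 h).resolve_right hm₀, zero_smul]

theorem annihilatorOfDegree_eq_zero [Module k M]
    [IsScalarTower k (UniversalEnvelopingAlgebra k 𝔤) M] (h0 : 𝓰 0 = ⊥)
    (hm₀ : m₀ ≠ 0) {j : ℤ} (hj : j < 1)
    {a : UniversalEnvelopingAlgebra k 𝔤} (ha : a ∈ annihilatorOfDegree 𝓰 m₀ j) : a = 0 := by
  rcases (Int.lt_add_one_iff.1 hj : j ≤ 0).lt_or_eq with h | h
  · exact eq_zero_of_mem_neg h ha.1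
  · subst h
    exact eq_zero_of_mem_zero_of_smul h0 hm₀ ha.1 ha.2

end Annihilator

/-! ### Generators and syzygies of the annihilator, read off from Tor. -/

namespace GradedFreeResolution

open DirectSum

variable {k : Type u} [Field k] {𝔤 : Type v} [LieRing 𝔤] [LieAlgebra k 𝔤]
  {𝓰 : ℕ → Submodule k 𝔤} {M : Type w} [AddCommGroup M] [Module k M]
  [Module (UniversalEnvelopingAlgebra k 𝔤) M] {𝓜 : ℤ → Submodule k M}
  (F : GradedFreeResolution 𝓰 𝓜) {m₀ : M}

/-- A comparison between the resolution `F` and the presentation `U(𝔤) → M`, `a ↦ a • m₀`, in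
homological degree zero. -/
structure Comparison (m₀ : M) where
  α : UniversalEnvelopingAlgebra k 𝔤 →ₗ[UniversalEnvelopingAlgebra k 𝔤]
    (F.ι 0 →₀ UniversalEnvelopingAlgebra k 𝔤)
  β : (F.ι 0 →₀ UniversalEnvelopingAlgebra k 𝔤) →ₗ[UniversalEnvelopingAlgebra k 𝔤]
    UniversalEnvelopingAlgebra k 𝔤
  α_mem : ∀ j, ∀ a ∈ envelopingGrading 𝓰 j, α a ∈ freeGrading 𝓰 (F.δ 0) j
  β_mem : ∀ j, ∀ f ∈ freeGrading 𝓰 (F.δ 0) j, β f ∈ envelopingGrading 𝓰 j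
  ε_α : ∀ a, F.ε (α a) = a • m₀
  β_smul : ∀ f, β f • m₀ = F.ε f
  β_α : ∀ a, β (α a) = a

theorem exists_comparison [GradedLieAlgebra 𝓰] [Decomposition 𝓜]
    [SetLike.GradedSMul (envelopingGrading 𝓰) 𝓜]
    [IsScalarTower k (UniversalEnvelopingAlgebra k 𝔤) M] (h0 : 𝓰 0 = ⊥) (hm : m₀ ∈ 𝓜 0)
    (hm₀ : m₀ ≠ 0) (hspan : Submodule.span (UniversalEnvelopingAlgebra k 𝔤) {m₀} = ⊤) :
    Nonempty (F.Comparison m₀) := by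
  obtain ⟨f₀, hf₀, hε⟩ := F.exists_ε_eq hm
  have hA : ∀ j, ∀ a ∈ envelopingGrading 𝓰 j, LinearMap.toSpanSingleton
      (UniversalEnvelopingAlgebra k 𝔤) M m₀ a ∈ 𝓜 j := by
    intro j a ha
    have := SetLike.GradedSMul.smul_mem (A := envelopingGrading 𝓰) (B := 𝓜) ha hm
    rwa [vadd_eq_add, add_zero] at this
  have hu : ∀ x : F.ι 0, ∃ u ∈ envelopingGrading 𝓰 (F.δ 0 x),
      u • m₀ = F.ε (Finsupp.single x 1) := by
    intro x
    obtain ⟨u, hu⟩ := Submodule.mem_span_singleton.1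
      (hspan ▸ Submodule.mem_top : F.ε (Finsupp.single x 1) ∈ _)
    refine ⟨decompose (envelopingGrading 𝓰) u (F.δ 0 x), SetLike.coe_mem _, ?_⟩
    have e := decompose_map_of_homogeneous _ 𝓜 _ hA u (F.δ 0 x)
    rw [LinearMap.toSpanSingleton_apply, LinearMap.toSpanSingleton_apply, hu,
      decompose_of_mem_same _ (F.ε_homogeneous _ _ (basis_mem_freeGrading x))] at e
    exact e.symm
  choose u hu hum using hu
  let α := LinearMap.toSpanSingleton (UniversalEnvelopingAlgebra k 𝔤)
    (F.ι 0 →₀ UniversalEnvelopingAlgebra k 𝔤) f₀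
  let β := Finsupp.linearCombination (UniversalEnvelopingAlgebra k 𝔤) u
  have hβ : ∀ j, ∀ f ∈ freeGrading 𝓰 (F.δ 0) j, β f ∈ envelopingGrading 𝓰 j :=
    map_mem_of_basis _ β fun x => by simpa [β] using hu x
  have hβs : ∀ f, β f • m₀ = F.ε f := by
    have : (LinearMap.toSpanSingleton (UniversalEnvelopingAlgebra k 𝔤) M m₀).comp β = F.ε := by
      ext x
      simp [β, hum]
    exact fun f => LinearMap.congr_fun this f
  -- The difference is a scalar, being of degree zero, and it annihilates the nonzero element `m₀`.
  have h1 : β f₀ = 1 := by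
    rw [← sub_eq_zero]
    refine eq_zero_of_mem_zero_of_smul h0 hm₀ (sub_mem (hβ 0 _ hf₀) SetLike.GradedOne.one_mem) ?_
    rw [sub_smul, hβs, hε, one_smul, sub_self]
  refine ⟨⟨α, β, fun j a ha => ?_, hβ, fun a => ?_, hβs, fun a => ?_⟩⟩
  · have := SetLike.GradedSMul.smul_mem (A := envelopingGrading 𝓰)
      (B := freeGrading 𝓰 (F.δ 0)) ha hf₀
    rwa [vadd_eq_add, add_zero] at this
  · simp [α, hε]
  · simp [α, h1]

variable {F} (C : F.Comparison m₀)

namespace Comparison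

theorem α_mem_range {a : UniversalEnvelopingAlgebra k 𝔤} (ha : a • m₀ = 0) :
    C.α a ∈ Set.range (F.d 0) :=
  (F.exact_zero _).1 (by rw [C.ε_α, ha])

theorem β_d_smul (f : F.ι 1 →₀ UniversalEnvelopingAlgebra k 𝔤) : C.β (F.d 0 f) • m₀ = 0 := by
  rw [C.β_smul, F.ε_d]

theorem β_d_mem {j : ℤ} {f : F.ι 1 →₀ UniversalEnvelopingAlgebra k 𝔤}
    (hf : f ∈ freeGrading 𝓰 (F.δ 1) j) : C.β (F.d 0 f) ∈ annihilatorOfDegree 𝓰 m₀ j :=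
  ⟨C.β_mem _ _ (F.d_homogeneous _ _ _ hf), C.β_d_smul f⟩

theorem reduction_α {a : UniversalEnvelopingAlgebra k 𝔤} (ha : augmentation k 𝔤 a = 0) :
    reduction k 𝔤 _ (C.α a) = 0 := by
  have : C.α a = a • C.α 1 := by rw [← map_smul, smul_eq_mul, mul_one]
  rw [this, reduction_smul, ha, zero_smul]

theorem β_d_eq_zero_of_reduction [IsScalarTower k (UniversalEnvelopingAlgebra k 𝔤) M]
    (h0 : 𝓰 0 = ⊥) (hm₀ : m₀ ≠ 0)
    {f : F.ι 1 →₀ UniversalEnvelopingAlgebra k 𝔤} (hf : f ∈ freeGrading 𝓰 (F.δ 1) 1)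
    (hred : reduction k 𝔤 _ f = 0) : C.β (F.d 0 f) = 0 :=
  (Submodule.mem_bot _).1 <| map_mem_of_reduction_eq_zero h0 (C.β.comp (F.d 0)) ⊥ hf hred
    fun x hx => (Submodule.mem_bot _).2 <| annihilatorOfDegree_eq_zero h0 hm₀ hx
      (C.β_d_mem (basis_mem_freeGrading x))

variable [GradedLieAlgebra 𝓰]

/-- If `Tor_1` is concentrated in degree one, then the annihilator of the generator is generated
by its part of degree one. -/
theorem annihilatorOfDegree_le [IsScalarTower k (UniversalEnvelopingAlgebra k 𝔤) M]
    (C : F.Comparison m₀) (h0 : 𝓰 0 = ⊥) (hm₀ : m₀ ≠ 0)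
    (hTor : ∀ j ≠ 1, Module.rank k (F.Tor 1 j) = 0) : ∀ j,
    ∀ a ∈ annihilatorOfDegree 𝓰 m₀ j, a ∈ Submodule.span (UniversalEnvelopingAlgebra k 𝔤)
      (annihilatorOfDegree 𝓰 m₀ 1 : Set (UniversalEnvelopingAlgebra k 𝔤)) := by
  refine Int.induction_of_bounded_below 1 (fun j hj a ha => ?_) fun j ih a ha => ?_
  · rw [annihilatorOfDegree_eq_zero h0 hm₀ hj ha]; exact zero_mem _
  · by_cases hj : j = 1
    · subst hj; exact Submodule.subset_span ha
    by_cases hj0 : j = 0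
    · subst hj0
      rw [annihilatorOfDegree_eq_zero h0 hm₀ zero_lt_one ha]; exact zero_mem _
    -- Now `a = β (α a) = β (d f)`, where `f` involves only basis elements of degree below `j`;
    -- their images under `β ∘ d` lie in the annihilator and are covered by induction.
    obtain ⟨f, hf, hred, hfa⟩ := F.exists_d_eq_of_rank_eq_zero (hTor j hj) (C.α_mem _ _ ha.1)
      (C.α_mem_range ha.2) (C.reduction_α (augmentation_eq_zero_of_mem hj0 ha.1))
    rw [← C.β_α a, ← hfa]
    exact map_mem_of_reduction_eq_zero h0 (C.β.comp (F.d 0)) _ hf hred fun x hx =>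
      ih _ hx _ (C.β_d_mem (basis_mem_freeGrading x))

/-- The part of degree one of `Tor_1` has the dimension of the part of degree one of the
annihilator of the generator. -/
theorem finrank_annihilatorOfDegree_one [IsScalarTower k (UniversalEnvelopingAlgebra k 𝔤) M]
    (C : F.Comparison m₀) (h0 : 𝓰 0 = ⊥) (hm₀ : m₀ ≠ 0) :
    Module.finrank k (annihilatorOfDegree 𝓰 m₀ 1) = Module.finrank k (F.Tor 1 1) := by
  -- `Φ` maps the cycles of degree one onto the degree one part of the annihilator. The rest shows
  -- that its kernel there consists of the boundaries.
  let Φ : (F.ι 1 →₀ k) →ₗ[k] UniversalEnvelopingAlgebra k 𝔤 :=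
    (C.β.restrictScalars k ∘ₗ (F.d 0).restrictScalars k) ∘ₗ constants k 𝔤 (F.ι 1)
  have hΦ (c : F.ι 1 →₀ k) : Φ c = C.β (F.d 0 (constants k 𝔤 _ c)) := rfl
  have himage : annihilatorOfDegree 𝓰 m₀ 1 = (F.cyclesOfDegree 1 1).map Φ := by
    apply le_antisymm
    · intro a ha
      obtain ⟨f, hf, hfa⟩ := F.exists_d_eq (C.α_mem _ _ ha.1) (C.α_mem_range ha.2)
      have hcyc : reduction k 𝔤 _ f ∈ F.cyclesOfDegree 1 1 := by
        refine ⟨?_, reduction_mem_supported hf⟩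
        change tensorTrivial (F.d 0) _ = 0
        rw [← reduction_map, hfa, C.reduction_α (augmentation_eq_zero_of_mem one_ne_zero ha.1)]
      refine ⟨_, hcyc, ?_⟩
      rw [hΦ, ← sub_eq_zero, ← C.β_α a, ← hfa, ← map_sub, ← map_sub]
      refine C.β_d_eq_zero_of_reduction h0 hm₀ (sub_mem (constants_mem hcyc.2) hf) ?_
      rw [map_sub, reduction_constants, sub_self]
    · rintro _ ⟨c, hc, rfl⟩
      exact C.β_d_mem (constants_mem hc.2)
  have hh : ∀ x : F.ι 0, ∃ g, F.d 0 g =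
      C.α (C.β (Finsupp.single x 1)) - Finsupp.single x 1 := fun x =>
    (F.exact_zero _).1 (by rw [map_sub, C.ε_α, C.β_smul, sub_self])
  choose g hg using hh
  -- A contracting homotopy in homological degree zero: `d ∘ h = α ∘ β - id`.
  let h := Finsupp.linearCombination (UniversalEnvelopingAlgebra k 𝔤) g
  have hd : ∀ f, F.d 0 (h f) = C.α (C.β f) - f := by
    have : (F.d 0).comp h = C.α.comp C.β - LinearMap.id := by
      ext1 x
      ext1
      simp [h, hg]
    exact fun f => LinearMap.congr_fun this f
  rw [himage]
  refine Submodule.finrank_map_eq_of_ker_eq _ _ _ fun c hc => ?_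
  rw [hΦ, Submodule.mkQ_apply, Submodule.Quotient.mk_eq_zero]
  set f := constants k 𝔤 _ c with hf
  have hfm : f ∈ freeGrading 𝓰 (F.δ 1) 1 := constants_mem hc.2
  have hfc : reduction k 𝔤 _ f = c := reduction_constants c
  constructor
  · intro h1
    -- The homotopy turns `β (d f) = 0` into an honest cycle of the resolution. The correction term
    -- has zero reduction because `d f` does.
    have h2 : F.d 0 (f + h (F.d 0 f)) = 0 := by
      rw [map_add, hd, h1, map_zero]; abel
    obtain ⟨e, he⟩ := (F.exact 0 _).1 h2
    have h3 : reduction k 𝔤 _ (F.d 0 f) = 0 := by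
      rw [reduction_map, hfc]; exact hc.1
    have h4 : reduction k 𝔤 _ (F.d 1 e) = c := by
      rw [he, map_add, hfc, reduction_map_eq_zero h h3, add_zero]
    rw [← h4]
    exact F.reduction_d_mem_boundaries e
  · intro hb
    obtain ⟨f', hf', hred, e, he⟩ := F.exists_reduction_eq_zero hfm (hfc ▸ hb)
    have h1 := C.β_d_eq_zero_of_reduction h0 hm₀ hf' hred
    rwa [← he, map_sub, F.d_d, sub_zero] at h1

/-- If the part of degree one of the annihilator of the generator has the basis `x 0, x 1` and
generates the annihilator, and `Tor_2` vanishes in degrees less than `D`, then `x 0, x 1` have no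
syzygies in degrees less than `D`. -/
theorem syzygy_eq_zero (C : F.Comparison m₀) (h0 : 𝓰 0 = ⊥)
    {x : Fin 2 → UniversalEnvelopingAlgebra k 𝔤}
    (hx : LinearIndependent k x) (hxm : ∀ i, x i ∈ annihilatorOfDegree 𝓰 m₀ 1)
    (hgen : ∀ j, ∀ a ∈ annihilatorOfDegree 𝓰 m₀ j,
      a ∈ Submodule.span (UniversalEnvelopingAlgebra k 𝔤) (Set.range x))
    {D : ℤ} (hTor : ∀ j < D, Module.rank k (F.Tor 2 j) = 0) : ∀ j : ℤ,
    j < D → ∀ s ∈ freeGrading 𝓰 (fun _ : Fin 2 => 1) j,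
      Finsupp.linearCombination (UniversalEnvelopingAlgebra k 𝔤) x s = 0 → s = 0 := by
  set dG := Finsupp.linearCombination (UniversalEnvelopingAlgebra k 𝔤) x with hdG
  have hdGm : ∀ j, ∀ f ∈ freeGrading 𝓰 (fun _ : Fin 2 => 1) j, dG f ∈ envelopingGrading 𝓰 j :=
    map_mem_of_basis _ dG fun i => by simpa [hdG] using (hxm i).1
  have hone : ∀ s ∈ freeGrading 𝓰 (fun _ : Fin 2 => 1) 1, dG s = 0 → s = 0 := by
    intro s hs h
    have hs' : ∀ i, ∃ c : k, s i = c • 1 := fun i =>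
      exists_smul_one_of_mem_zero h0 (by simpa using hs i)
    choose c hc using hs'
    have h1 : ∑ i, c i • x i = 0 := by
      rw [← h, hdG, Finsupp.linearCombination_apply, Finsupp.sum_fintype _ _ (by simp)]
      exact Finset.sum_congr rfl fun i _ => by rw [hc, smul_assoc, one_smul]
    ext i
    rw [hc, Fintype.linearIndependent_iff.1 hx c h1 i, zero_smul]; rfl
  have hp : ∀ i, ∃ p ∈ freeGrading 𝓰 (F.δ 1) 1, F.d 0 p = C.α (x i) := fun i =>
    F.exists_d_eq (C.α_mem _ _ (hxm i).1) (C.α_mem_range (hxm i).2)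
  choose p hp hdp using hp
  -- `α₁` and `β₁` lift `α` and `β` to homological degree one, between `F` and the free module on
  -- two generators of degree one.
  let α₁ := Finsupp.linearCombination (UniversalEnvelopingAlgebra k 𝔤) p
  have hα₁ : ∀ s, F.d 0 (α₁ s) = C.α (dG s) := by
    have : (F.d 0).comp α₁ = C.α.comp dG := by
      ext1 i
      ext1
      simp [α₁, hdG, hdp]
    exact fun s => LinearMap.congr_fun this s
  have hα₁m : ∀ j, ∀ s ∈ freeGrading 𝓰 (fun _ : Fin 2 => 1) j,
      α₁ s ∈ freeGrading 𝓰 (F.δ 1) j :=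
    map_mem_of_basis _ α₁ fun i => by simpa [α₁] using hp i
  have hq : ∀ t : F.ι 1, ∃ q ∈ freeGrading 𝓰 (fun _ : Fin 2 => 1) (F.δ 1 t),
      dG q = C.β (F.d 0 (Finsupp.single t 1)) := by
    intro t
    have ht := C.β_d_mem (basis_mem_freeGrading (𝓰 := 𝓰) (δ := F.δ 1) t)
    have h1 := hgen _ _ ht
    rw [← Finsupp.range_linearCombination] at h1
    obtain ⟨q, hq⟩ := h1
    refine ⟨decompose (freeGrading 𝓰 fun _ : Fin 2 => 1) q (F.δ 1 t), SetLike.coe_mem _, ?_⟩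
    rw [← decompose_map_of_homogeneous _ (envelopingGrading 𝓰) dG hdGm, hq,
      decompose_of_mem_same _ ht.1]
  choose q hq hdq using hq
  let β₁ := Finsupp.linearCombination (UniversalEnvelopingAlgebra k 𝔤) q
  have hβ₁ : ∀ f, dG (β₁ f) = C.β (F.d 0 f) := by
    have : dG.comp β₁ = C.β.comp (F.d 0) := by
      ext1 t
      ext1
      simp [β₁, hdq]
    exact fun f => LinearMap.congr_fun this f
  have hβ₁m : ∀ j, ∀ f ∈ freeGrading 𝓰 (F.δ 1) j,
      β₁ f ∈ freeGrading 𝓰 (fun _ : Fin 2 => 1) j :=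
    map_mem_of_basis _ β₁ fun t => by simpa [β₁] using hq t
  -- On a basis vector the difference is a syzygy of degree one, that is, a scalar relation between
  -- the independent elements `x i`.
  have hβα : ∀ s, β₁ (α₁ s) = s := by
    have : β₁.comp α₁ = LinearMap.id := by
      ext1 i
      ext1
      simp only [LinearMap.comp_apply, Finsupp.lsingle_apply, LinearMap.id_apply]
      rw [← sub_eq_zero]
      have hi := basis_mem_freeGrading (𝓰 := 𝓰) (δ := fun _ : Fin 2 => 1) i
      refine hone _ (sub_mem (hβ₁m _ _ (hα₁m _ _ hi)) hi) ?_
      rw [map_sub, hβ₁, hα₁, C.β_α, sub_self]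
    exact fun s => LinearMap.congr_fun this s
  refine Int.induction_of_bounded_below 1 (fun j hj _ s hs _ => ?_)
    fun j ih hjD s hs h => ?_
  · ext i
    exact eq_zero_of_mem_neg (sub_neg.2 hj) (hs i)
  · by_cases hj : j = 1
    · subst hj; exact hone s hs h
    have hred : reduction k 𝔤 _ s = 0 := reduction_eq_zero_iff.2 fun i =>
      augmentation_eq_zero_of_mem (sub_ne_zero.2 hj) (hs i)
    -- Then `s = β₁ (d f)` is a combination of syzygies of degree below `j`, all zero by induction.
    obtain ⟨f, hf, hfred, hfs⟩ := F.exists_d_eq_of_rank_eq_zero (hTor j hjD) (hα₁m _ _ hs)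
      ((F.exact 0 _).1 (by rw [hα₁, h, map_zero])) (reduction_map_eq_zero α₁ hred)
    rw [← hβα s, ← hfs]
    refine (Submodule.mem_bot (UniversalEnvelopingAlgebra k 𝔤)).1 <|
      map_mem_of_reduction_eq_zero h0 (β₁.comp (F.d 1)) ⊥ hf hfred fun t ht =>
        (Submodule.mem_bot _).2 <| ih _ ht (ht.trans hjD) _ ?_ ?_
    · exact hβ₁m _ _ (F.d_homogeneous _ _ _ (basis_mem_freeGrading t))
    · rw [LinearMap.comp_apply, hβ₁, F.d_d, map_zero]

end Comparison

end GradedFreeResolution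

/-! ### The bracket relation in dimension four and the syzygy it produces. -/

section LieAlgebras

open DirectSum

variable {k : Type u} [Field k] {𝔤 : Type v} [LieRing 𝔤] [LieAlgebra k 𝔤]
  {𝓰 : ℕ → Submodule k 𝔤}

/-- In a four-dimensional graded Lie algebra, two linearly independent elements of degree one
satisfy a bracket relation of degree three. -/
theorem exists_bracket_relation [GradedLieAlgebra 𝓰] (hdim : Module.finrank k 𝔤 = 4) {x y : 𝔤}
    (hx : x ∈ 𝓰 1) (hy : y ∈ 𝓰 1) (hxy : LinearIndependent k ![x, y]) :
    ∃ a b : k, (a ≠ 0 ∨ b ≠ 0) ∧ a • ⁅x, ⁅x, y⁆⁆ + b • ⁅y, ⁅x, y⁆⁆ = 0 := by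
  have : FiniteDimensional k 𝔤 := Module.finite_of_finrank_pos (by omega)
  by_contra! hcon
  have hz : ⁅x, y⁆ ∈ 𝓰 2 := SetLike.GradedBracket.bracket_mem hx hy
  have hu : ⁅x, ⁅x, y⁆⁆ ∈ 𝓰 3 := SetLike.GradedBracket.bracket_mem hx hz
  have hv : ⁅y, ⁅x, y⁆⁆ ∈ 𝓰 3 := SetLike.GradedBracket.bracket_mem hy hz
  -- If `x` and `y` commuted, both triple brackets would vanish and any coefficients would do.
  have hz0 : ⁅x, y⁆ ≠ 0 := fun h => hcon 1 0 (Or.inl one_ne_zero) (by simp [h])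
  have hli : LinearIndependent k ![x, y, ⁅x, y⁆, ⁅x, ⁅x, y⁆⁆, ⁅y, ⁅x, y⁆⁆] := by
    rw [Fintype.linearIndependent_iff]
    intro c hc
    simp only [Fin.sum_univ_five, Matrix.cons_val] at hc
    have h1 : c 0 • x + c 1 • y ∈ 𝓰 1 :=
      add_mem (Submodule.smul_mem _ _ hx) (Submodule.smul_mem _ _ hy)
    have h2 : c 2 • ⁅x, y⁆ ∈ 𝓰 2 := Submodule.smul_mem _ _ hz
    have h3 : c 3 • ⁅x, ⁅x, y⁆⁆ + c 4 • ⁅y, ⁅x, y⁆⁆ ∈ 𝓰 3 :=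
      add_mem (Submodule.smul_mem _ _ hu) (Submodule.smul_mem _ _ hv)
    have hcomp (j : ℕ) : (decompose 𝓰 (c 0 • x + c 1 • y) j : 𝔤) +
        decompose 𝓰 (c 2 • ⁅x, y⁆) j +
        decompose 𝓰 (c 3 • ⁅x, ⁅x, y⁆⁆ + c 4 • ⁅y, ⁅x, y⁆⁆) j = 0 := by
      have h := congrArg (fun m => (decompose 𝓰 m j : 𝔤)) hc
      rw [add_assoc (_ + _)] at h
      rw [decompose_add, decompose_add 𝓰 (_ + _) (c 2 • _)] at h
      simpa using h
    have e1 := hcomp 1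
    rw [decompose_of_mem_same _ h1, decompose_of_mem_ne _ h2 (by decide),
      decompose_of_mem_ne _ h3 (by decide), add_zero, add_zero] at e1
    have e2 := hcomp 2
    rw [decompose_of_mem_ne _ h1 (by decide), decompose_of_mem_same _ h2,
      decompose_of_mem_ne _ h3 (by decide), add_zero, zero_add] at e2
    have e3 := hcomp 3
    rw [decompose_of_mem_ne _ h1 (by decide), decompose_of_mem_ne _ h2 (by decide),
      decompose_of_mem_same _ h3, zero_add, zero_add] at e3
    obtain ⟨c0, c1⟩ := LinearIndependent.pair_iff.1 hxy _ _ e1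
    have c2 := (smul_eq_zero.1 e2).resolve_right hz0
    have c34 : c 3 = 0 ∧ c 4 = 0 := by
      by_contra h
      exact hcon _ _ (by tauto) e3
    intro i
    fin_cases i
    exacts [c0, c1, c2, c34.1, c34.2]
  have := hli.fintype_card_le_finrank
  rw [hdim, Fintype.card_fin] at this
  omega

attribute [local instance 100] LieRing.ofAssociativeRing

/-- A linear form on the part of degree one of a positively graded Lie algebra extends to a
character of the enveloping algebra. -/
theorem exists_character [GradedLieAlgebra 𝓰] (h0 : 𝓰 0 = ⊥) (f : 𝔤 →ₗ[k] k) :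
    ∃ χ : UniversalEnvelopingAlgebra k 𝔤 →ₐ[k] k,
      ∀ x ∈ 𝓰 1, χ (UniversalEnvelopingAlgebra.ι k x) = f x := by
  let π : 𝔤 →ₗ[k] 𝔤 := (𝓰 1).subtype ∘ₗ component k ℕ (fun i => 𝓰 i) 1 ∘ₗ
    (decomposeLinearEquiv 𝓰).toLinearMap
  have hπ (x : 𝔤) : π x = decompose 𝓰 x 1 := rfl
  -- With no part of degree zero, brackets live in degrees at least two, so the projection to degree
  -- one kills them.
  have hbr : ∀ x y : 𝔤, π ⁅x, y⁆ = 0 := by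
    intro x y
    induction x using Decomposition.inductionOn 𝓰 with
    | zero => simp
    | add x x' h h' => rw [add_lie, map_add, h, h', add_zero]
    | @homogeneous i x =>
      induction y using Decomposition.inductionOn 𝓰 with
      | zero => simp
      | add y y' h h' => rw [lie_add, map_add, h, h', add_zero]
      | @homogeneous j y =>
        have hz {z : 𝔤} (h : z ∈ 𝓰 0) : z = 0 := by rwa [h0, Submodule.mem_bot] at h
        by_cases hi : i = 0
        · subst hi; rw [hz x.2, zero_lie, map_zero]
        by_cases hj : j = 0
        · subst hj; rw [hz y.2, lie_zero, map_zero]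
        exact decompose_of_mem_ne 𝓰 (SetLike.GradedBracket.bracket_mem x.2 y.2) (by omega)
  refine ⟨UniversalEnvelopingAlgebra.lift k { f ∘ₗ π with map_lie' := fun {x y} => ?_ },
    fun x hx => ?_⟩
  · change f (π ⁅x, y⁆) = _
    rw [hbr, map_zero, LieRing.of_associative_ring_bracket, mul_comm, sub_self]
  · rw [UniversalEnvelopingAlgebra.lift_ι_apply]
    change f (π x) = f x
    rw [hπ, decompose_of_mem_same 𝓰 hx]

theorem exists_linearForm_of_linearIndependent {V : Type*} [AddCommGroup V] [Module k V] {n : ℕ}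
    {x : Fin n → V} (hx : LinearIndependent k x) (c : Fin n → k) :
    ∃ f : V →ₗ[k] k, ∀ i, f (x i) = c i := by
  obtain ⟨f, hf⟩ := LinearMap.exists_extend (Finsupp.linearCombination k c ∘ₗ hx.repr)
  refine ⟨f, fun i => ?_⟩
  have hi : x i ∈ Submodule.span k (Set.range x) := Submodule.subset_span ⟨i, rfl⟩
  have h := LinearMap.congr_fun hf ⟨x i, hi⟩
  simpa [hx.repr_eq_single i ⟨x i, hi⟩ rfl] using h

/-- Expand the triple commutators and sort the monomials by their last factor. The coefficients on
the left are the cofactors of that last factor. -/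
theorem syzygy_identity {K A : Type*} [CommRing K] [Ring A] [Algebra K A] (a b : K) (X Y : A) :
    (a • (Y * X - (2 : K) • (X * Y)) - b • (Y * Y)) * X +
      (a • (X * X) + b • ((2 : K) • (Y * X) - X * Y)) * Y =
    a • (X * (X * Y - Y * X) - (X * Y - Y * X) * X) +
      b • (Y * (X * Y - Y * X) - (X * Y - Y * X) * Y) := by
  simp only [sub_mul, add_mul, mul_sub, smul_mul_assoc, mul_assoc]
  module

/-- Two linearly independent elements of degree one of a four-dimensional positively graded Lie
algebra have a nonzero syzygy of degree three in the enveloping algebra. -/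
theorem exists_syzygy_of_degree_three [GradedLieAlgebra 𝓰] (h0 : 𝓰 0 = ⊥)
    (hdim : Module.finrank k 𝔤 = 4) {x y : 𝔤} (hx : x ∈ 𝓰 1) (hy : y ∈ 𝓰 1)
    (hxy : LinearIndependent k ![x, y]) :
    ∃ s ∈ freeGrading 𝓰 (fun _ : Fin 2 => 1) 3, s ≠ 0 ∧
      Finsupp.linearCombination (UniversalEnvelopingAlgebra k 𝔤)
        ![UniversalEnvelopingAlgebra.ι k x, UniversalEnvelopingAlgebra.ι k y] s = 0 := by
  obtain ⟨a, b, hab, hrel⟩ := exists_bracket_relation hdim hx hy hxy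
  set X := UniversalEnvelopingAlgebra.ι k x with hX
  set Y := UniversalEnvelopingAlgebra.ι k y with hY
  have hXm : X ∈ envelopingGrading 𝓰 1 := by exact_mod_cast ι_mem_envelopingGrading hx
  have hYm : Y ∈ envelopingGrading 𝓰 1 := by exact_mod_cast ι_mem_envelopingGrading hy
  have hmul {P Q : UniversalEnvelopingAlgebra k 𝔤} (hP : P ∈ envelopingGrading 𝓰 1)
      (hQ : Q ∈ envelopingGrading 𝓰 1) : P * Q ∈ envelopingGrading 𝓰 2 := by
    rw [← one_add_one_eq_two]
    exact SetLike.mul_mem_graded hP hQ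
  let p := a • (Y * X - (2 : k) • (X * Y)) - b • (Y * Y)
  let q := a • (X * X) + b • ((2 : k) • (Y * X) - X * Y)
  have hp : p ∈ envelopingGrading 𝓰 2 :=
    sub_mem (Submodule.smul_mem _ _ (sub_mem (hmul hYm hXm) (Submodule.smul_mem _ _ (hmul hXm hYm))))
      (Submodule.smul_mem _ _ (hmul hYm hYm))
  have hq : q ∈ envelopingGrading 𝓰 2 :=
    add_mem (Submodule.smul_mem _ _ (hmul hXm hXm))
      (Submodule.smul_mem _ _ (sub_mem (Submodule.smul_mem _ _ (hmul hYm hXm)) (hmul hXm hYm)))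
  refine ⟨Finsupp.single 0 p + Finsupp.single 1 q, add_mem
    (single_mem_freeGrading hp (by norm_num)) (single_mem_freeGrading hq (by norm_num)), ?_, ?_⟩
  · intro h
    have hp0 : p = 0 := by simpa using DFunLike.congr_fun h 0
    have hq0 : q = 0 := by simpa using DFunLike.congr_fun h 1
    -- The character with values 1 at `X` and 0 at `Y` sends `q` to `a`; the one with the values
    -- exchanged sends `p` to `-b`.
    obtain ⟨f, hf⟩ := exists_linearForm_of_linearIndependent hxy ![1, 0]
    obtain ⟨g, hg⟩ := exists_linearForm_of_linearIndependent hxy ![0, 1]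
    obtain ⟨χ, hχ⟩ := exists_character h0 f
    obtain ⟨ψ, hψ⟩ := exists_character h0 g
    have fx : χ X = 1 := (hχ x hx).trans (hf 0)
    have fy : χ Y = 0 := (hχ y hy).trans (hf 1)
    have gx : ψ X = 0 := (hψ x hx).trans (hg 0)
    have gy : ψ Y = 1 := (hψ y hy).trans (hg 1)
    have ha : a = 0 := by simpa [q, fx, fy] using congrArg χ hq0
    have hb : b = 0 := by simpa [p, gx, gy] using congrArg ψ hp0
    exact hab.elim (· ha) (· hb)
  · have h := congrArg (UniversalEnvelopingAlgebra.ι k) hrel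
    simp only [map_add, map_smul, LieHom.map_lie, LieRing.of_associative_ring_bracket,
      map_zero] at h
    rw [map_add, Finsupp.linearCombination_single, Finsupp.linearCombination_single]
    exact (syzygy_identity a b X Y).trans h

end LieAlgebras

/-! ### The numerical table and the contradiction. -/

theorem isPrimitiveIntegralPoint_one_two_five_six_two :
    IsPrimitiveIntegralPoint (n := 4) ![0, 1, 4, 5, 6] ![1, 2, 5, 6, 2] := by
  refine ⟨?_, by decide, fun β hβ => ⟨β 0, ?_⟩⟩
  · intro m hm
    interval_cases m <;> decide
  · have h0 := hβ 0 (by norm_num)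
    have h1 := hβ 1 (by norm_num)
    have h2 := hβ 2 (by norm_num)
    have h3 := hβ 3 (by norm_num)
    simp [Fin.sum_univ_five] at h0 h1 h2 h3
    ext i
    fin_cases i <;> simp <;> omega

open DirectSum in
/-- The Betti table of a module of finite length over the enveloping algebra of a four-dimensional
positively graded Lie algebra is not the table `(1, 2, 5, 6, 2)` of degrees `(0, 1, 4, 5, 6)`. -/
theorem not_isBettiTable_pureTable {k : Type u} [Field k] {𝔤 : Type v} [LieRing 𝔤]
    [LieAlgebra k 𝔤] (𝓰 : ℕ → Submodule k 𝔤) [GradedLieAlgebra 𝓰] (h0 : 𝓰 0 = ⊥)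
    (hdim : Module.finrank k 𝔤 = 4) {M : Type w} [AddCommGroup M] [Module k M]
    [Module (UniversalEnvelopingAlgebra k 𝔤) M] [IsScalarTower k (UniversalEnvelopingAlgebra k 𝔤) M]
    (𝓜 : ℤ → Submodule k M) [Decomposition 𝓜] [SetLike.GradedSMul (envelopingGrading 𝓰) 𝓜]
    [Module.Finite (UniversalEnvelopingAlgebra k 𝔤) M] :
    ¬ IsBettiTable 𝓰 𝓜 (pureTable (n := 4) ![0, 1, 4, 5, 6] ![1, 2, 5, 6, 2]) := by
  rintro ⟨F, hF⟩
  obtain ⟨m₀, hm, hm₀, hspan⟩ := F.exists_generator h0 (by simp [hF, pureTable])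
    fun j hj => by simp [hF, pureTable, hj.symm]
  obtain ⟨C⟩ := F.exists_comparison h0 hm hm₀ hspan
  have hle := C.annihilatorOfDegree_le h0 hm₀ fun j hj => by simp [hF, pureTable, hj.symm]
  have hrank : Module.finrank k (annihilatorOfDegree 𝓰 m₀ 1) = 2 := by
    rw [C.finrank_annihilatorOfDegree_one h0 hm₀]
    exact Module.finrank_eq_of_rank_eq (by simp [hF, pureTable])
  have : Module.Finite k (annihilatorOfDegree 𝓰 m₀ 1) :=
    Module.finite_of_finrank_pos (by omega)
  let b := Module.finBasisOfFinrankEq k (annihilatorOfDegree 𝓰 m₀ 1) hrank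
  obtain ⟨x, hx, hxb⟩ := exists_ι_of_mem_one h0 (b 0).2.1
  obtain ⟨y, hy, hyb⟩ := exists_ι_of_mem_one h0 (b 1).2.1
  have hbv : (fun i => (b i : UniversalEnvelopingAlgebra k 𝔤)) =
      ![UniversalEnvelopingAlgebra.ι k x, UniversalEnvelopingAlgebra.ι k y] := by
    funext i
    fin_cases i
    exacts [hxb.symm, hyb.symm]
  have hli : LinearIndependent k fun i => (b i : UniversalEnvelopingAlgebra k 𝔤) :=
    b.linearIndependent.map' (annihilatorOfDegree 𝓰 m₀ 1).subtype (Submodule.ker_subtype _)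
  -- Independence is pulled back along `ι`, which does not require `ι` to be injective.
  have hxy : LinearIndependent k ![x, y] := by
    rw [hbv] at hli
    rw [LinearIndependent.pair_iff] at hli ⊢
    intro s t hst
    refine hli s t ?_
    rw [← map_smul, ← map_smul, ← map_add, hst, map_zero]
  have hgen : ∀ j, ∀ a ∈ annihilatorOfDegree 𝓰 m₀ j,
      a ∈ Submodule.span (UniversalEnvelopingAlgebra k 𝔤)
        (Set.range fun i => (b i : UniversalEnvelopingAlgebra k 𝔤)) := by
    intro j a ha
    refine Submodule.span_le.2 ?_ (hle j a ha)
    intro z hz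
    have hz' := congrArg Subtype.val (b.sum_repr ⟨z, hz⟩)
    rw [← show _ = z from hz', Submodule.coe_sum]
    refine sum_mem fun i _ => ?_
    rw [Submodule.coe_smul, ← algebraMap_smul (UniversalEnvelopingAlgebra k 𝔤)]
    exact Submodule.smul_mem _ _ (Submodule.subset_span ⟨i, rfl⟩)
  obtain ⟨s, hs, hs0, hsyz⟩ := exists_syzygy_of_degree_three h0 hdim hx hy hxy
  -- The bound is `d_2 = 4`: Tor in homological degree 2 vanishes below it, while the syzygy has
  -- degree 3.
  refine hs0 (C.syzygy_eq_zero h0 hli (fun i => (b i).2) hgen (D := 4) (fun j hj => ?_) 3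
    (by norm_num) s hs (by rw [hbv]; exact hsyz))
  simp [hF, pureTable, hj.ne']

theorem mainTheorem7 (k : Type*) [Field k] :
    StrictMono (![0, 1, 4, 5, 6] : Fin (4 + 1) → ℤ) ∧
    IsPrimitiveIntegralPoint (n := 4) ![0, 1, 4, 5, 6] ![1, 2, 5, 6, 2] ∧
    ∀ (𝔤 : Type*) [LieRing 𝔤] [LieAlgebra k 𝔤] (𝓰 : ℕ → Submodule k 𝔤) [GradedLieAlgebra 𝓰],
      𝓰 0 = ⊥ →
      LieSubalgebra.lieSpan k 𝔤 (𝓰 1 : Set 𝔤) = ⊤ →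
      Module.finrank k 𝔤 = 4 →
      ∀ (M : Type*) [AddCommGroup M] [Module k M] [Module (UniversalEnvelopingAlgebra k 𝔤) M]
        [IsScalarTower k (UniversalEnvelopingAlgebra k 𝔤) M]
        (𝓜 : ℤ → Submodule k M) [DirectSum.Decomposition 𝓜]
        [SetLike.GradedSMul (envelopingGrading 𝓰) 𝓜],
        IsFiniteLength (UniversalEnvelopingAlgebra k 𝔤) M →
        ¬ IsBettiTable 𝓰 𝓜 (pureTable (n := 4) ![0, 1, 4, 5, 6] ![1, 2, 5, 6, 2]) := by
  refine ⟨by decide, isPrimitiveIntegralPoint_one_two_five_six_two, ?_⟩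
  intro 𝔤 _ _ 𝓰 _ h0 _ hdim M _ _ _ _ 𝓜 _ _ hfl
  -- Finite length gives a Noetherian module, hence a finitely generated one.
  have := (isFiniteLength_iff_isNoetherian_isArtinian.1 hfl).1
  exact not_isBettiTable_pureTable 𝓰 h0 hdim 𝓜
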